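/- Let $k$ be a field, $r\ge 1$ an integer, and $B=k\langle x,y\rangle/(y^{r+1})$ with the $\mathbb Z$-grading $\deg x=\deg y=1$. Let $\mathsf{Gr}\,B$ be the category of $\mathbb Z$-graded left $B$-modules with degree-preserving homomorphisms, $\mathsf{Fdim}\,B\subset\mathsf{Gr}\,B$ the Serre subcategory of modules that are unions of their finite dimensional submodules, and $\mathsf{QGr}\,B=\mathsf{Gr}\,B/\mathsf{Fdim}\,B$ with quotient functor $\beta^*:\mathsf{Gr}\,B\to\mathsf{QGr}\,B$. Let $\mathsf{gr}\,B\subset\mathsf{Gr}\,B$ be the full subcategory of finitely presented modules, $\mathsf{fdim}\,B\subset\mathsf{gr}\,B$ the full subcategory of finite dimensional modules, and $\mathsf{qgr}\,B=\mathsf{gr}\,B/\mathsf{fdim}\,B$; the quotient categories are the localizations at the morphisms whose kernel and cokernel lie in $\mathsf{Fdim}\,B$, respectively $\mathsf{fdim}\,B$. Then $\mathsf{qgr}\,B$ is an abelian category in which every object is both injective and projective, and every short exact sequence in $\mathsf{qgr}\,B$ splits. Moreover every object of $\mathsf{qgr}\,B$ is projective in $\mathsf{QGr}\,B$: for every $M\in\mathsf{gr}\,B$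 the object $\beta^*M$ is projective in $\mathsf{QGr}\,B$. -/

import Mathlib

open CategoryTheory

universe u

namespace PenroseCurve

/-- The relation `y ^ (r + 1) = 0` on the free algebra `k⟨x, y⟩`, where `x` and `y` are the
generators with index `0` and `1`. -/
def Rel (k : Type u) [Field k] (r : ℕ) (a b : FreeAlgebra k (Fin 2)) : Prop :=
  a = FreeAlgebra.ι k (1 : Fin 2) ^ (r + 1) ∧ b = 0

/-- The algebra `B = k⟨x, y⟩ / (y ^ (r + 1))`. -/
abbrev Alg (k : Type u) [Field k] (r : ℕ) : Type u := RingQuot (Rel k r)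

/-- The classes of `x` (index `0`) and `y` (index `1`) in `B`. -/
def gen (k : Type u) [Field k] (r : ℕ) (i : Fin 2) : Alg k r :=
  RingQuot.mkAlgHom k (Rel k r) (FreeAlgebra.ι k i)

/-- The homogeneous components `B_n`, `n ∈ ℤ`, for the grading with `deg x = deg y = 1`:
for `n ≥ 0` the `k`-span of the words of length `n` in `x` and `y`, and `0` for `n < 0`. -/
def component (k : Type u) [Field k] (r : ℕ) : ℤ → Submodule k (Alg k r)
  | Int.ofNat n => Submodule.span k (Set.range (gen k r)) ^ n
  | Int.negSucc _ => ⊥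

/-- A `ℤ`-graded left `B`-module: a left `B`-module `M` (regarded as a `k`-vector space through
`k → B`) with subspaces `M_i` such that `M = ⨁ M_i` and `B_i M_j ⊆ M_{i+j}`. -/
structure Gr (k : Type u) [Field k] (r : ℕ) where
  carrier : Type u
  [addCommGroup : AddCommGroup carrier]
  [moduleBase : Module k carrier]
  [module : Module (Alg k r) carrier]
  [isScalarTower : IsScalarTower k (Alg k r) carrier]
  deg : ℤ → Submodule k carrier
  isInternal : DirectSum.IsInternal deg
  smul_mem : ∀ {i j : ℤ} {b : Alg k r} {m : carrier},
    b ∈ component k r i → m ∈ deg j → b • m ∈ deg (i + j)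

attribute [instance] Gr.addCommGroup Gr.moduleBase Gr.module Gr.isScalarTower

/-- Morphisms of graded modules: `B`-linear maps of degree `0`. -/
@[ext]
structure Gr.Hom {k : Type u} [Field k] {r : ℕ} (M N : Gr k r) where
  lin : M.carrier →ₗ[Alg k r] N.carrier
  map_mem : ∀ {i : ℤ} {m : M.carrier}, m ∈ M.deg i → lin m ∈ N.deg i

/-- The category `Gr B`. -/
instance (k : Type u) [Field k] (r : ℕ) : Category (Gr k r) where
  Hom := Gr.Hom
  id _ := ⟨LinearMap.id, fun h => h⟩
  comp f g := ⟨g.lin.comp f.lin, fun h => g.map_mem (f.map_mem h)⟩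

/-- A left `B`-module is the union of its finite dimensional submodules: each element lies in a
submodule that is finite dimensional over `k`. For a graded module it makes no difference
whether these submodules are required to be graded, because `B` is generated by two elements of
degree `1`. -/
def IsUnionFinDim (k : Type u) [Field k] (r : ℕ) (M : Type u) [AddCommGroup M] [Module k M]
    [Module (Alg k r) M] [IsScalarTower k (Alg k r) M] : Prop :=
  ∀ m : M, ∃ P : Submodule (Alg k r) M, m ∈ P ∧ Module.Finite k P

/-- The morphisms of `Gr B` whose kernel and cokernel belong to the Serre subcategory `Fdim B` of
modules that are unions of their finite dimensional submodules. -/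
def isoModFdim (k : Type u) [Field k] (r : ℕ) : MorphismProperty (Gr k r) :=
  fun M N (f : Gr.Hom M N) =>
    IsUnionFinDim k r (LinearMap.ker f.lin) ∧
      IsUnionFinDim k r (N.carrier ⧸ LinearMap.range f.lin)

/-- `QGr B = Gr B / Fdim B`: the Serre quotient, that is, the localization of `Gr B` at the
morphisms whose kernel and cokernel lie in `Fdim B`. -/
abbrev QGr (k : Type u) [Field k] (r : ℕ) := (isoModFdim k r).Localization

/-- The quotient functor `β^* : Gr B ⥤ QGr B`. -/
abbrev betaStar (k : Type u) [Field k] (r : ℕ) : Gr k r ⥤ QGr k r := (isoModFdim k r).Q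

/-- `gr B`: the full subcategory of `Gr B` of finitely presented modules. (A graded module is
finitely presented as a graded module if and only if it is so as a module.) -/
abbrev FpGr (k : Type u) [Field k] (r : ℕ) :=
  ObjectProperty.FullSubcategory
    (fun M : Gr k r => Module.FinitePresentation (Alg k r) M.carrier)

/-- The morphisms of `gr B` whose kernel and cokernel are finite dimensional. -/
def isoModFinDim (k : Type u) [Field k] (r : ℕ) : MorphismProperty (FpGr k r) :=
  fun M N f =>
    let g : Gr.Hom M.obj N.obj := f.hom
    Module.Finite k (LinearMap.ker g.lin) ∧
      Module.Finite k (N.obj.carrier ⧸ LinearMap.range g.lin)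

/-- `qgr B = gr B / fdim B`: the Serre quotient, that is, the localization of `gr B` at the
morphisms whose kernel and cokernel lie in the subcategory `fdim B` of finite dimensional
modules. -/
abbrev FpQGr (k : Type u) [Field k] (r : ℕ) := (isoModFinDim k r).Localization

end PenroseCurve

/-! Modulo finite dimensional modules, every finitely presented graded module M is free, with
generators in degrees as large as desired (`Gr.exists_free_hom`). In all large degrees, M_{n+1} = x
M_n + y M_n, and x m₀ + y m₁ = 0 forces m₀ = 0 and m₁ ∈ y^r M (`Gr.exists_isTame`). For free modules
the second property comes from Fox derivatives; finite generation of the relations carries it over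
to M. For such a degree m, choose bases of the spaces y^j M_m, 0 ≤ j ≤ r. The elements x w, with w
in these bases, freely generate a submodule F, and M_{m+t} = F_{m+t} ⊕ y^t M_m for all t ≥ 0. Since
y^(r+1) = 0, F and M agree in degrees above m + r.

Free modules are projective in Gr B, and their generators can be moved into any submodule with
torsion quotient. So for f : F → N in gr B with F free and cokernel p : N → C, a free replacement of
C lifts to N and splits p in qgr B, while a free replacement of N, corrected by this splitting,
factors through f. Hence every morphism of qgr B has a split cokernel whose complement lies in the
image (`FpGr.hasSplitCokernels`). In an additive category this alone yields kernels, cokernels,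
normality and the splitting of all monomorphisms and epimorphisms. The same lifting applied to roofs
gives projectivity in QGr B (`exists_lift_betaStar`). -/

namespace PenroseCurve

/-! ### Additive categories in which every morphism has a split cokernel. -/

section SplitCokernels

open Limits

universe v w

variable {C : Type w} [Category.{v} C] [Preadditive C]

/-- A localization of a preadditive category having a right calculus of fractions is preadditive. -/
theorem exists_preadditive_localization (W : MorphismProperty C) [W.HasRightCalculusOfFractions] :
    ∃ _ : Preadditive W.Localization, W.Q.Additive := by
  -- A right calculus for W is a left calculus for `W.op`, so the additive structure is built on the
  -- opposite category and brought back through the double opposite.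
  let _ : Preadditive W.Localizationᵒᵖ := Localization.preadditive W.Q.op W.op
  have : W.Q.op.Additive := Localization.functor_additive W.Q.op W.op
  let e := (opOpEquivalence W.Localization).symm.fullyFaithfulFunctor
  let _ : Preadditive W.Localization := Preadditive.ofFullyFaithful e
  have : (opOpEquivalence W.Localization).symm.functor.Additive :=
    Functor.FullyFaithful.additive_ofFullyFaithful e
  refine ⟨inferInstance, ⟨fun {X Y f g} => ?_⟩⟩
  apply (opOpEquivalence W.Localization).symm.functor.map_injective
  rw [Functor.map_add (F := (opOpEquivalence W.Localization).symm.functor)]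
  apply Quiver.Hom.unop_inj
  exact W.Q.op.map_add (f := f.op) (g := g.op)

/-- Every morphism has a cokernel that is split, with a complement contained in the image. -/
def HasSplitCokernels (C : Type w) [Category.{v} C] [Preadditive C] : Prop :=
  ∀ ⦃X Y : C⦄ (f : X ⟶ Y), ∃ (g : Y ⟶ X) (Z : C) (p : Y ⟶ Z) (s : Z ⟶ Y),
    f ≫ p = 0 ∧ s ≫ p = 𝟙 Z ∧ g ≫ f + p ≫ s = 𝟙 Y

namespace HasSplitCokernels

variable (h : HasSplitCokernels C)
include h

/-- Composing the splitting identity with f kills the cokernel term. This von Neumann regularity is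
the source of all retractions, sections and kernels below. -/
theorem exists_regular {X Y : C} (f : X ⟶ Y) : ∃ g : Y ⟶ X, f ≫ g ≫ f = f := by
  obtain ⟨g, Z, p, s, h₁, -, h₃⟩ := h f
  refine ⟨g, ?_⟩
  have := f ≫= h₃
  rwa [Preadditive.comp_add, reassoc_of% h₁, zero_comp, add_zero, Category.comp_id] at this

/-- The split cokernel of 1 - e is the image of e; composing the section with e removes the term
that passes through 1 - e. -/
theorem exists_split {X : C} (e : X ⟶ X) (he : e ≫ e = e) :
    ∃ (Z : C) (p : X ⟶ Z) (s : Z ⟶ X), p ≫ s = e ∧ s ≫ p = 𝟙 Z := by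
  obtain ⟨g, Z, p, s, h₁, h₂, h₃⟩ := h (𝟙 X - e)
  have hp : e ≫ p = p := by
    rw [Preadditive.sub_comp, Category.id_comp, sub_eq_zero] at h₁
    exact h₁.symm
  refine ⟨Z, p, s ≫ e, ?_, by rw [Category.assoc, hp, h₂]⟩
  have := h₃ =≫ e
  simpa [Preadditive.add_comp, Preadditive.sub_comp, he] using this

theorem exists_retraction {X Y : C} (f : X ⟶ Y) [Mono f] : ∃ g, f ≫ g = 𝟙 X := by
  obtain ⟨g, hg⟩ := h.exists_regular f
  exact ⟨g, by rw [← cancel_mono f, Category.assoc, hg, Category.id_comp]⟩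

theorem exists_section {X Y : C} (f : X ⟶ Y) [Epi f] : ∃ g, g ≫ f = 𝟙 Y := by
  obtain ⟨g, hg⟩ := h.exists_regular f
  exact ⟨g, by rw [← cancel_epi f, hg, Category.comp_id]⟩

/-- Because f g f = f, the morphism 1 - f g is idempotent, and splitting it gives the kernel of f.
-/
theorem hasKernels : HasKernels C where
  has_limit {X Y} f := by
    obtain ⟨g, hg⟩ := h.exists_regular f
    obtain ⟨Z, p, s, h₁, h₂⟩ := h.exists_split (𝟙 X - f ≫ g) (by
      simp [Preadditive.sub_comp, Preadditive.comp_sub, reassoc_of% hg])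
    have hs : s ≫ f = 0 := by
      have : s ≫ (p ≫ s) ≫ f = 0 := by
        rw [h₁]; simp [Preadditive.sub_comp, hg]
      simpa [reassoc_of% h₂] using this
    have : Mono s := (SplitMono.mk p h₂).mono
    exact ⟨_, KernelFork.IsLimit.ofι' s hs fun t ht => ⟨t ≫ p, by
      rw [Category.assoc, h₁]; simp [reassoc_of% ht]⟩⟩

theorem hasCokernels : HasCokernels C where
  has_colimit {X Y} f := by
    obtain ⟨g, Z, p, s, h₁, h₂, h₃⟩ := h f
    have : Epi p := (SplitEpi.mk s h₂).epi
    exact ⟨_, CokernelCofork.IsColimit.ofπ' p h₁ fun t ht => ⟨s ≫ t, by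
      have := h₃ =≫ t
      simpa [Preadditive.add_comp, ht] using this⟩⟩

theorem nonempty_normalMono {X Y : C} (f : X ⟶ Y) [Mono f] : Nonempty (NormalMono f) := by
  obtain ⟨g, hg⟩ := h.exists_retraction f
  refine ⟨⟨Y, 𝟙 Y - g ≫ f, by simp [Preadditive.comp_sub, reassoc_of% hg],
    KernelFork.IsLimit.ofι' f _ fun t ht => ⟨t ≫ g, ?_⟩⟩⟩
  rw [Preadditive.comp_sub, Category.comp_id, sub_eq_zero] at ht
  rw [Category.assoc, ← ht]

theorem nonempty_normalEpi {X Y : C} (f : X ⟶ Y) [Epi f] : Nonempty (NormalEpi f) := by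
  obtain ⟨g, hg⟩ := h.exists_section f
  refine ⟨⟨X, 𝟙 X - f ≫ g, by simp [Preadditive.sub_comp, hg],
    CokernelCofork.IsColimit.ofπ' f _ fun t ht => ⟨g ≫ t, ?_⟩⟩⟩
  rw [Preadditive.sub_comp, Category.id_comp, sub_eq_zero] at ht
  rw [← Category.assoc, ← ht]

theorem injective (X : C) : Injective X where
  factors g f _ := by
    obtain ⟨p, hp⟩ := h.exists_retraction f
    exact ⟨p ≫ g, by rw [reassoc_of% hp]⟩

theorem projective (X : C) : Projective X where
  factors g f _ := by
    obtain ⟨s, hs⟩ := h.exists_section f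
    exact ⟨g ≫ s, by rw [Category.assoc, hs, Category.comp_id]⟩

/-- The abelian structure of a preadditive category in which all morphisms have split cokernels. -/
@[reducible]
noncomputable def abelian [HasFiniteProducts C] : Abelian C :=
  have := h.hasKernels
  have := h.hasCokernels
  have : IsNormalMonoCategory C := ⟨fun f _ => h.nonempty_normalMono f⟩
  have : IsNormalEpiCategory C := ⟨fun f _ => h.nonempty_normalEpi f⟩
  {}

theorem nonempty_splitting (S : ShortComplex C) (hS : S.ShortExact) : Nonempty S.Splitting := by
  have : IsNormalMonoCategory C := ⟨fun f _ => h.nonempty_normalMono f⟩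
  have := hS.mono_f
  have := hS.epi_g
  obtain ⟨g, hg⟩ := h.exists_retraction S.f
  exact ⟨.ofExactOfRetraction S hS.exact g hg inferInstance⟩

end HasSplitCokernels

end SplitCokernels

/-! ### The algebra B: universal property and grading. -/

variable {k : Type u} [Field k] {r : ℕ}

theorem gen_one_pow : gen k r 1 ^ (r + 1) = 0 := by
  have h : Rel k r (FreeAlgebra.ι k (1 : Fin 2) ^ (r + 1)) 0 := ⟨rfl, rfl⟩
  have := RingQuot.mkAlgHom_rel k h
  simpa [gen] using this

/-- The universal property of `B`. -/
def algLift {A : Type*} [Ring A] [Algebra k A] (f : Fin 2 → A) (hf : f 1 ^ (r + 1) = 0) :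
    Alg k r →ₐ[k] A :=
  RingQuot.liftAlgHom k ⟨FreeAlgebra.lift k f, by rintro _ _ ⟨rfl, rfl⟩; simpa using hf⟩

@[simp]
theorem algLift_gen {A : Type*} [Ring A] [Algebra k A] (f : Fin 2 → A)
    (hf : f 1 ^ (r + 1) = 0) (i : Fin 2) : algLift f hf (gen k r i) = f i := by
  simp [algLift, gen]

theorem alg_induction {P : Alg k r → Prop} (algebraMap : ∀ c, P (algebraMap k _ c))
    (gen : ∀ i, P (gen k r i)) (mul : ∀ a b, P a → P b → P (a * b))
    (add : ∀ a b, P a → P b → P (a + b)) (b : Alg k r) : P b := by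
  obtain ⟨a, rfl⟩ := RingQuot.mkAlgHom_surjective k (Rel k r) b
  induction a with
  | grade0 c => simpa using algebraMap c
  | grade1 i => exact gen i
  | mul a b ha hb => rw [map_mul]; exact mul _ _ ha hb
  | add a b ha hb => rw [map_add]; exact add _ _ ha hb

theorem component_natCast (n : ℕ) :
    component k r n = Submodule.span k (Set.range (gen k r)) ^ n := rfl

theorem component_of_neg {n : ℤ} (hn : n < 0) : component k r n = ⊥ := by
  cases n with
  | ofNat n => exact absurd hn (by simp)
  | negSucc n => rfl

theorem gen_mem (i : Fin 2) : gen k r i ∈ component k r 1 := by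
  have : component k r 1 = Submodule.span k (Set.range (gen k r)) ^ 1 := rfl
  rw [this, pow_one]
  exact Submodule.subset_span ⟨i, rfl⟩

theorem component_zero : component k r 0 = 1 := pow_zero _

theorem algebraMap_mem (c : k) : algebraMap k (Alg k r) c ∈ component k r 0 := by
  rw [component_zero]; exact Submodule.algebraMap_mem c

theorem one_mem_component : (1 : Alg k r) ∈ component k r 0 := by
  simpa using algebraMap_mem (r := r) (1 : k)

theorem mul_mem_component {i j : ℤ} {a b : Alg k r} (ha : a ∈ component k r i)
    (hb : b ∈ component k r j) : a * b ∈ component k r (i + j) := by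
  rcases lt_or_ge i 0 with hi | hi
  · rw [component_of_neg hi, Submodule.mem_bot] at ha
    simp [ha]
  rcases lt_or_ge j 0 with hj | hj
  · rw [component_of_neg hj, Submodule.mem_bot] at hb
    simp [hb]
  lift i to ℕ using hi
  lift j to ℕ using hj
  rw [← Nat.cast_add]
  rw [component_natCast] at *
  rw [pow_add]
  exact Submodule.mul_mem_mul ha hb

theorem pow_mem_component {a : Alg k r} (ha : a ∈ component k r 1) (n : ℕ) :
    a ^ n ∈ component k r n := by
  induction n with
  | zero => simpa using one_mem_component
  | succ n ih => rw [pow_succ]; simpa using mul_mem_component ih ha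

/-- The degree n = -1 is excluded because B_0 consists of constants while B_{-1} = 0; for smaller n
everything vanishes. -/
theorem exists_eq_of_mem_component_add_one {n : ℤ} {b : Alg k r} (hn : n ≠ -1)
    (hb : b ∈ component k r (n + 1)) :
    ∃ b₀ ∈ component k r n, ∃ b₁ ∈ component k r n, b = gen k r 0 * b₀ + gen k r 1 * b₁ := by
  rcases lt_or_ge n 0 with h | h
  · rw [component_of_neg (by omega), Submodule.mem_bot] at hb
    exact ⟨0, zero_mem _, 0, zero_mem _, by simp [hb]⟩
  lift n to ℕ using h
  have hb' : b ∈ Submodule.span k (Set.range (gen k r)) ^ (n + 1) := hb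
  rw [pow_succ'] at hb'
  induction hb' using Submodule.mul_induction_on' with
  | mem_mul_mem a ha c hc =>
    change c ∈ component k r n at hc
    induction ha using Submodule.span_induction with
    | mem a ha =>
      obtain ⟨i, rfl⟩ := ha
      fin_cases i
      · exact ⟨c, hc, 0, zero_mem _, by simp⟩
      · exact ⟨0, zero_mem _, c, hc, by simp⟩
    | zero => exact ⟨0, zero_mem _, 0, zero_mem _, by simp⟩
    | add a a' ha ha' h h' =>
      have hm : ∀ a ∈ Submodule.span k (Set.range (gen k r)),
          a * c ∈ component k r ((n : ℤ) + 1) := by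
        intro a ha
        have := mul_mem_component (i := 1) (by simpa [component] using ha) hc
        rwa [add_comm] at this
      obtain ⟨b₀, h₀, b₁, h₁, e⟩ := h (hm _ ha)
      obtain ⟨b₀', h₀', b₁', h₁', e'⟩ := h' (hm _ ha')
      exact ⟨b₀ + b₀', add_mem h₀ h₀', b₁ + b₁', add_mem h₁ h₁', by
        rw [add_mul, e, e']; noncomm_ring⟩
    | smul t a ha h =>
      have hm : a * c ∈ component k r ((n : ℤ) + 1) := by
        have := mul_mem_component (i := 1) (by simpa [component] using ha) hc
        rwa [add_comm] at this
      obtain ⟨b₀, h₀, b₁, h₁, e⟩ := h hm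
      exact ⟨t • b₀, Submodule.smul_mem _ _ h₀, t • b₁, Submodule.smul_mem _ _ h₁, by
        rw [smul_mul_assoc, e]; simp [smul_add]⟩
  | add a ha a' ha' h h' =>
    obtain ⟨b₀, h₀, b₁, h₁, e⟩ := h (by rw [← pow_succ'] at ha; exact ha)
    obtain ⟨b₀', h₀', b₁', h₁', e'⟩ := h' (by rw [← pow_succ'] at ha'; exact ha')
    exact ⟨b₀ + b₀', add_mem h₀ h₀', b₁ + b₁', add_mem h₁ h₁', by
      rw [e, e']; noncomm_ring⟩

/-- A family of subspaces with projections is a direct sum decomposition if it spans. -/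
theorem isInternal_of_projections {M : Type*} [AddCommGroup M] [Module k M]
    (deg : ℤ → Submodule k M) {N : Type*} [AddCommGroup N] [Module k N]
    (p : ℤ → M →ₗ[k] N) (hp : ∀ i, ∀ m ∈ deg i, p i m = 0 → m = 0)
    (hp' : ∀ i j, j ≠ i → ∀ m ∈ deg j, p i m = 0) (htop : ⨆ i, deg i = ⊤) :
    DirectSum.IsInternal deg := by
  rw [DirectSum.isInternal_submodule_iff_iSupIndep_and_iSup_eq_top]
  refine ⟨fun i => ?_, htop⟩
  rw [Submodule.disjoint_def]
  intro m hm hm'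
  refine hp i m hm ?_
  have : (⨆ j, ⨆ (_ : j ≠ i), deg j) ≤ LinearMap.ker (p i) :=
    iSup₂_le fun j hj m hm => hp' i j hj m hm
  exact this hm'

/-- The coaction `B → B[T]` defining the grading. -/
noncomputable def coaction (k : Type u) [Field k] (r : ℕ) :
    Alg k r →ₐ[k] Polynomial (Alg k r) :=
  algLift (fun i => Polynomial.monomial 1 (gen k r i)) (by
    rw [Polynomial.monomial_pow, gen_one_pow, map_zero])

theorem coaction_of_mem {n : ℕ} {b : Alg k r} (hb : b ∈ component k r n) :
    coaction k r b = Polynomial.monomial n b := by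
  induction n generalizing b with
  | zero =>
    rw [Nat.cast_zero, component_zero, Submodule.mem_one] at hb
    obtain ⟨c, rfl⟩ := hb
    rw [AlgHom.commutes]; rfl
  | succ n ih =>
    obtain ⟨b₀, h₀, b₁, h₁, rfl⟩ :=
      exists_eq_of_mem_component_add_one (n := n) (by omega) (by simpa using hb)
    rw [map_add, map_mul, map_mul, ih h₀, ih h₁]
    simp [coaction, Polynomial.monomial_mul_monomial, add_comm 1 n]

theorem iSup_component : ⨆ i, component k r i = ⊤ := by
  rw [eq_top_iff]
  rintro b -
  induction b using alg_induction with
  | algebraMap c => exact Submodule.mem_iSup_of_mem 0 (algebraMap_mem c)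
  | gen i => exact Submodule.mem_iSup_of_mem 1 (gen_mem i)
  | add a b ha hb => exact add_mem ha hb
  | mul a b ha hb =>
    induction ha using Submodule.iSup_induction' with
    | zero => simp
    | add a a' _ _ h h' => rw [add_mul]; exact add_mem h h'
    | mem i a ha =>
      induction hb using Submodule.iSup_induction' with
      | zero => simp
      | add a a' _ _ h h' => rw [mul_add]; exact add_mem h h'
      | mem j b hb => exact Submodule.mem_iSup_of_mem (i + j) (mul_mem_component ha hb)

/-- The coefficient of T^i in the coaction is the projection to B_i, which gives independence of the
components. -/
theorem isInternal_component : DirectSum.IsInternal (component k r) := by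
  refine isInternal_of_projections _ (fun i => if 0 ≤ i then
    (Polynomial.lcoeff _ i.toNat).restrictScalars k ∘ₗ (coaction k r).toLinearMap else 0)
    ?_ ?_ iSup_component
  · intro i b hb h
    rcases lt_or_ge i 0 with hi | hi
    · rwa [component_of_neg hi] at hb
    lift i to ℕ using hi
    simpa [coaction_of_mem hb] using h
  · intro i j hj b hb
    rcases lt_or_ge i 0 with hi | hi
    · simp [not_le.mpr hi]
    rcases lt_or_ge j 0 with hj' | hj'
    · rw [component_of_neg hj', Submodule.mem_bot] at hb
      simp [hb]
    lift j to ℕ using hj'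
    lift i to ℕ using hi
    have : j ≠ i := by exact_mod_cast hj
    simp [coaction_of_mem hb, Polynomial.coeff_monomial, this]

theorem finite_component (n : ℤ) : Module.Finite k (component k r n) := by
  cases n with
  | ofNat n =>
    rw [Module.Finite.iff_fg]
    exact (Submodule.fg_span (Set.finite_range _)).pow n
  | negSucc n => rw [component_of_neg (by simp)]; infer_instance

/-! ### Fox derivatives and the linear relations between x and y. -/

/-- The right action of a generator on the extension of `k` by `Q` defined by a class `q`. -/
def extensionMap {Q : Type*} [AddCommGroup Q] [Module k Q] (f : Module.End k Q) (q : Q) :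
    Module.End k (Q × k) :=
  LinearMap.inl k Q k ∘ₗ LinearMap.coprod f (LinearMap.toSpanSingleton k Q q)

theorem extensionMap_apply {Q : Type*} [AddCommGroup Q] [Module k Q] (f : Module.End k Q)
    (q : Q) (z : Q × k) : extensionMap f q z = (f z.1 + z.2 • q, 0) := by
  simp [extensionMap]

theorem extensionMap_pow_succ {Q : Type*} [AddCommGroup Q] [Module k Q] (f : Module.End k Q)
    (q : Q) (n : ℕ) (z : Q × k) :
    (extensionMap f q ^ (n + 1)) z = ((f ^ (n + 1)) z.1 + z.2 • (f ^ n) q, 0) := by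
  induction n with
  | zero => simp [extensionMap_apply]
  | succ n ih =>
    rw [pow_succ', Module.End.mul_apply, ih, extensionMap_apply]
    simp [pow_succ' f]

open MulOpposite in
/-- Fox derivatives: a derivation from `B` to a right module `Q` is determined by its values on
the generators, subject to one condition. -/
theorem exists_derivation {Q : Type*} [AddCommGroup Q] [Module k Q]
    (ρ : Alg k r →ₐ[k] (Module.End k Q)ᵐᵒᵖ) (q : Fin 2 → Q)
    (hq : (unop (ρ (gen k r 1)) ^ r) (q 1) = 0) :
    ∃ D : Alg k r →ₗ[k] Q, ∀ i b, D (gen k r i * b) = unop (ρ b) (q i) := by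
  -- The right action on the extension Q × k, in which the generator i sends (0, 1) to (q i, 0). Its
  -- compatibility with y^(r+1) = 0 is `hq`.
  let Φ : Alg k r →ₐ[k] (Module.End k (Q × k))ᵐᵒᵖ :=
    algLift (fun i => op (extensionMap (unop (ρ (gen k r i))) (q i))) (by
      rw [← op_pow, op_eq_zero_iff]
      ext : 1
      · ext z : 1
        simp only [LinearMap.comp_apply, extensionMap_pow_succ]
        simp [← unop_pow, ← map_pow, gen_one_pow]
      · ext
        all_goals simp [extensionMap_pow_succ, hq])
  have hΦ : ∀ (b : Alg k r) (z : Q), unop (Φ b) (z, 0) = (unop (ρ b) z, 0) := by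
    intro b
    induction b using alg_induction with
    | algebraMap c => intro z; simp [Algebra.algebraMap_eq_smul_one]
    | gen i => intro z; simp [Φ, extensionMap_apply]
    | mul a b ha hb => intro z; simp [ha, hb]
    | add a b ha hb => intro z; simp [ha, hb]
  -- D b is the Q-component of (0, 1) acted on by b.
  refine ⟨LinearMap.fst k Q k ∘ₗ LinearMap.applyₗ (0, 1) ∘ₗ
    (opLinearEquiv k).symm.toLinearMap ∘ₗ Φ.toLinearMap, fun i b => ?_⟩
  simp [Φ, extensionMap_apply, hΦ]

open MulOpposite in
/-- Right multiplication on the quotient of `B` by a right ideal `c B`. -/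
theorem exists_rightMul (c : Alg k r) :
    ∃ ρ : Alg k r →ₐ[k] (Module.End k (Alg k r ⧸ LinearMap.range (LinearMap.mulLeft k c)))ᵐᵒᵖ,
      ∀ b a, unop (ρ b) (Submodule.Quotient.mk a) = Submodule.Quotient.mk (a * b) := by
  have h (b : Alg k r) : LinearMap.range (LinearMap.mulLeft k c) ≤
      (LinearMap.range (LinearMap.mulLeft k c)).comap (LinearMap.mulRight k b) := by
    rintro _ ⟨a, rfl⟩
    exact ⟨a * b, by simp [mul_assoc]⟩
  refine ⟨AlgHom.ofLinearMap
    { toFun := fun b => op (Submodule.mapQ _ _ (LinearMap.mulRight k b) (h b))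
      map_add' := fun a b => ?_
      map_smul' := fun a b => ?_ } ?_ fun a b => ?_, fun b a => ?_⟩
  · apply unop_injective; ext z; simp [mul_add]
  · apply unop_injective; ext z; simp
  · apply unop_injective; ext z; simp
  · apply unop_injective; ext z; simp [mul_assoc]
  · simp

/-- The derivative ∂/∂x with values in B, written as B / 0B, sends x a + y b to a. -/
theorem eq_zero_of_gen_mul_add_eq_zero {a b : Alg k r}
    (h : gen k r 0 * a + gen k r 1 * b = 0) : a = 0 := by
  obtain ⟨ρ, hρ⟩ := exists_rightMul (0 : Alg k r)
  obtain ⟨D, hD⟩ := exists_derivation ρ ![Submodule.Quotient.mk 1, 0] (by simp)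
  have := congrArg D h
  rw [map_add, hD, hD] at this
  simp only [Matrix.cons_val_zero, hρ, Matrix.cons_val_one, map_zero, add_zero, one_mul] at this
  rw [Submodule.Quotient.mk_eq_zero] at this
  obtain ⟨z, hz⟩ := this
  simpa using hz.symm

/-- The derivative ∂/∂y with values in B / y^r B sends y b to the class of b; passing to this
quotient makes it compatible with y^(r+1) = 0. -/
theorem exists_eq_pow_mul_of_gen_mul_eq_zero {b : Alg k r} (h : gen k r 1 * b = 0) :
    ∃ c, b = gen k r 1 ^ r * c := by
  obtain ⟨ρ, hρ⟩ := exists_rightMul (gen k r 1 ^ r)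
  obtain ⟨D, hD⟩ := exists_derivation ρ ![0, Submodule.Quotient.mk 1] (by
    rw [← MulOpposite.unop_pow, ← map_pow]
    simp only [Matrix.cons_val_one, hρ, one_mul, Matrix.cons_val_fin_one]
    rw [Submodule.Quotient.mk_eq_zero]
    exact ⟨1, by simp⟩)
  have := congrArg D h
  rw [hD] at this
  simp only [hρ, Matrix.cons_val_one, map_zero, one_mul, Matrix.cons_val_fin_one] at this
  rw [Submodule.Quotient.mk_eq_zero] at this
  obtain ⟨z, hz⟩ := this
  exact ⟨z, by simpa using hz.symm⟩

/-! ### Homogeneous components of graded modules. -/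

namespace Gr

section Projections

/-- A graded module as the direct sum of its components. -/
noncomputable def decomposeEquiv (M : Gr k r) : M.carrier ≃ₗ[k] DirectSum ℤ fun i => M.deg i :=
  (LinearEquiv.ofBijective (DirectSum.coeLinearMap M.deg)
    (show Function.Bijective (DirectSum.coeLinearMap M.deg) from M.isInternal)).symm

/-- The projection of a graded module to its component of degree `i`. -/
noncomputable def proj (M : Gr k r) (i : ℤ) : M.carrier →ₗ[k] M.carrier :=
  (M.deg i).subtype ∘ₗ DirectSum.component k ℤ (fun i => M.deg i) i ∘ₗ
    M.decomposeEquiv.toLinearMap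

variable {M N : Gr k r}

theorem proj_mem (i : ℤ) (m : M.carrier) : M.proj i m ∈ M.deg i := by
  simp [proj]

theorem decomposeEquiv_of_mem {i : ℤ} {m : M.carrier} (hm : m ∈ M.deg i) :
    M.decomposeEquiv m =
      DirectSum.lof k ℤ (fun i => M.deg i) i ⟨m, hm⟩ := by
  rw [decomposeEquiv, LinearEquiv.symm_apply_eq]
  simp

theorem proj_of_mem {i : ℤ} {m : M.carrier} (hm : m ∈ M.deg i) : M.proj i m = m := by
  simp [proj, decomposeEquiv_of_mem hm, DirectSum.component.lof_self]

theorem proj_of_mem_of_ne {i j : ℤ} (h : j ≠ i) {m : M.carrier} (hm : m ∈ M.deg j) :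
    M.proj i m = 0 := by
  simp [proj, decomposeEquiv_of_mem hm, DirectSum.component.of, h]

theorem iSup_deg (M : Gr k r) : ⨆ i, M.deg i = ⊤ :=
  M.isInternal.submodule_iSup_eq_top

theorem homogeneous_induction {P : M.carrier → Prop} (zero : P 0)
    (add : ∀ a b, P a → P b → P (a + b)) (mem : ∀ i, ∀ m ∈ M.deg i, P m) (m : M.carrier) :
    P m := by
  have hm : m ∈ ⨆ i, M.deg i := M.iSup_deg ▸ Submodule.mem_top
  exact Submodule.iSup_induction M.deg (motive := P) hm mem zero add

theorem exists_sum_proj (m : M.carrier) :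
    ∃ s : Finset ℤ, (∀ i ∉ s, M.proj i m = 0) ∧ m = ∑ i ∈ s, M.proj i m := by
  induction m using homogeneous_induction with
  | zero => exact ⟨∅, by simp⟩
  | mem i m hm =>
    exact ⟨{i}, fun j hj => proj_of_mem_of_ne (by simpa [eq_comm] using hj) hm, by
      simp [proj_of_mem hm]⟩
  | add a b ha hb =>
    classical
    obtain ⟨s, hs, ha⟩ := ha
    obtain ⟨t, ht, hb⟩ := hb
    refine ⟨s ∪ t, fun i hi => ?_, ?_⟩
    · rw [Finset.notMem_union] at hi
      rw [map_add, hs i hi.1, ht i hi.2, add_zero]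
    · simp only [map_add, Finset.sum_add_distrib]
      conv_lhs => rw [ha, hb]
      congr 1
      · exact Finset.sum_subset Finset.subset_union_left fun i _ hi => hs i hi
      · exact Finset.sum_subset Finset.subset_union_right fun i _ hi => ht i hi

theorem proj_smul {i j : ℤ} {b : Alg k r} (hb : b ∈ component k r i) (m : M.carrier) :
    M.proj (i + j) (b • m) = b • M.proj j m := by
  induction m using homogeneous_induction with
  | zero => simp
  | add a b ha hb => simp [ha, hb]
  | mem l m hm =>
    by_cases h : l = j
    · subst h
      rw [proj_of_mem hm, proj_of_mem (M.smul_mem hb hm)]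
    · rw [proj_of_mem_of_ne h hm, proj_of_mem_of_ne (by omega) (M.smul_mem hb hm), smul_zero]

theorem Hom.map_proj (f : Gr.Hom M N) (i : ℤ) (m : M.carrier) :
    f.lin (M.proj i m) = N.proj i (f.lin m) := by
  induction m using homogeneous_induction with
  | zero => simp
  | add a b ha hb => simp [ha, hb]
  | mem l m hm =>
    by_cases h : l = i
    · subst h
      rw [proj_of_mem hm, proj_of_mem (f.map_mem hm)]
    · rw [proj_of_mem_of_ne h hm, proj_of_mem_of_ne h (f.map_mem hm), map_zero]

theorem Hom.exists_homogeneous_preimage (f : Gr.Hom M N) {i : ℤ} {n : N.carrier}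
    (hn : n ∈ N.deg i) (h : n ∈ LinearMap.range f.lin) : ∃ m ∈ M.deg i, f.lin m = n := by
  obtain ⟨m, rfl⟩ := h
  exact ⟨M.proj i m, proj_mem i m, by rw [f.map_proj, proj_of_mem hn]⟩

/-- The `B`-submodules generated by their homogeneous elements. -/
def IsHomogeneous (M : Gr k r) (S : Submodule (Alg k r) M.carrier) : Prop :=
  ∀ i, ∀ m ∈ S, M.proj i m ∈ S

theorem Hom.isHomogeneous_ker (f : Gr.Hom M N) : M.IsHomogeneous (LinearMap.ker f.lin) := by
  intro i m hm
  rw [LinearMap.mem_ker] at *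
  rw [f.map_proj, hm, map_zero]

theorem Hom.isHomogeneous_range (f : Gr.Hom M N) : N.IsHomogeneous (LinearMap.range f.lin) := by
  rintro i _ ⟨m, rfl⟩
  exact ⟨M.proj i m, f.map_proj i m⟩

end Projections

/-! ### Submodules, quotients, products and free modules in Gr B. -/

section Constructions

theorem isInternal_comap (M : Gr k r) {T : Type*} [AddCommGroup T] [Module k T]
    (f : T →ₗ[k] M.carrier) (hf : Function.Injective f)
    (hf' : ∀ i t, M.proj i (f t) ∈ LinearMap.range f) :
    DirectSum.IsInternal fun i => (M.deg i).comap f := by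
  refine isInternal_of_projections _ (fun i => M.proj i ∘ₗ f) ?_ ?_ ?_
  · intro i m hm h
    exact hf (((proj_of_mem hm).symm.trans h).trans (map_zero f).symm)
  · intro i j hj m hm
    exact proj_of_mem_of_ne hj hm
  · refine Submodule.eq_top_iff'.2 fun m => ?_
    obtain ⟨s, -, hs⟩ := exists_sum_proj (f m)
    choose g hg using fun i => hf' i m
    have : m = ∑ i ∈ s, g i := hf (by rw [map_sum, hs]; simp [hg, ← hs])
    rw [this]
    exact sum_mem fun i _ => Submodule.mem_iSup_of_mem i <| by
      rw [Submodule.mem_comap, hg]; exact proj_mem i _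

/-- The grading induced on a module by an injective map to a graded module with homogeneous
range. -/
abbrev comap (M : Gr k r) {T : Type u} [AddCommGroup T] [Module k T] [Module (Alg k r) T]
    [IsScalarTower k (Alg k r) T] (f : T →ₗ[Alg k r] M.carrier) (hf : Function.Injective f)
    (hf' : M.IsHomogeneous (LinearMap.range f)) : Gr k r where
  carrier := T
  deg i := (M.deg i).comap (f.restrictScalars k)
  isInternal := M.isInternal_comap _ hf fun i t => hf' i (f t) ⟨t, rfl⟩
  smul_mem := by
    intro i j b m hb hm
    simpa using M.smul_mem hb hm

/-- A homogeneous submodule as a graded module. -/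
abbrev sub (M : Gr k r) (S : Submodule (Alg k r) M.carrier) (hS : M.IsHomogeneous S) : Gr k r :=
  @comap k _ r M S S.addCommGroup S.module' S.module _ S.subtype S.subtype_injective
    (by rwa [Submodule.range_subtype])

/-- The inclusion of a homogeneous submodule. -/
def subι (M : Gr k r) (S : Submodule (Alg k r) M.carrier) (hS : M.IsHomogeneous S) :
    M.sub S hS ⟶ M :=
  @Gr.Hom.mk k _ r (M.sub S hS) M S.subtype fun h => h

/-- The quotient by a homogeneous submodule as a graded module. -/
abbrev quot (M : Gr k r) (S : Submodule (Alg k r) M.carrier) (hS : M.IsHomogeneous S) : Gr k r where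
  carrier := M.carrier ⧸ S
  deg i := (M.deg i).map (S.mkQ.restrictScalars k)
  isInternal := by
    have hp (i : ℤ) : S.restrictScalars k ≤ (S.restrictScalars k).comap (M.proj i) :=
      fun m hm => hS i m hm
    refine isInternal_of_projections _
      (fun i => Submodule.mapQ (S.restrictScalars k) (S.restrictScalars k) (M.proj i) (hp i) ∘ₗ
        (Submodule.Quotient.restrictScalarsEquiv k S).symm.toLinearMap) ?_ ?_ ?_
    · rintro i _ ⟨m, hm, rfl⟩ h
      change Submodule.Quotient.mk (M.proj i m) = _ at h
      rw [proj_of_mem hm, Submodule.Quotient.mk_eq_zero] at h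
      exact (Submodule.Quotient.mk_eq_zero _).2 h
    · rintro i j hj _ ⟨m, hm, rfl⟩
      change Submodule.Quotient.mk (M.proj i m) = _
      rw [proj_of_mem_of_ne hj hm]
      rfl
    · rw [← Submodule.map_iSup, iSup_deg, Submodule.map_top, LinearMap.range_eq_top]
      exact S.mkQ_surjective
  smul_mem := by
    rintro i j b _ hb ⟨m, hm, rfl⟩
    exact ⟨b • m, M.smul_mem hb hm, rfl⟩

/-- The projection to the quotient by a homogeneous submodule. -/
def quotπ (M : Gr k r) (S : Submodule (Alg k r) M.carrier) (hS : M.IsHomogeneous S) :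
    M ⟶ M.quot S hS :=
  Gr.Hom.mk S.mkQ fun h => ⟨_, h, rfl⟩

/-- The product of two graded modules. -/
abbrev prod (M N : Gr k r) : Gr k r where
  carrier := M.carrier × N.carrier
  deg i := (M.deg i).prod (N.deg i)
  isInternal := by
    refine isInternal_of_projections _ (fun i => (M.proj i).prodMap (N.proj i)) ?_ ?_ ?_
    · rintro i ⟨m, n⟩ ⟨hm, hn⟩ h
      simpa [proj_of_mem hm, proj_of_mem hn] using h
    · rintro i j hj ⟨m, n⟩ ⟨hm, hn⟩
      simpa using ⟨proj_of_mem_of_ne hj hm, proj_of_mem_of_ne hj hn⟩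
    · rw [eq_top_iff]
      rintro ⟨m, n⟩ -
      have : (m, n) = (m, 0) + (0, n) := by simp
      rw [this]
      refine add_mem ?_ ?_
      · induction m using homogeneous_induction with
        | zero => exact zero_mem _
        | add a b ha hb => simpa using add_mem (ha (by simp)) (hb (by simp))
        | mem i m hm => exact Submodule.mem_iSup_of_mem i ⟨hm, zero_mem _⟩
      · induction n using homogeneous_induction with
        | zero => exact zero_mem _
        | add a b ha hb => simpa using add_mem (ha (by simp)) (hb (by simp))
        | mem i m hm => exact Submodule.mem_iSup_of_mem i ⟨zero_mem _, hm⟩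
  smul_mem hb hm := ⟨M.smul_mem hb hm.1, N.smul_mem hb hm.2⟩

/-- The graded free module `⨁ B(-aᵢ)` on finitely many generators of degrees `aᵢ`. -/
abbrev free (k : Type u) [Field k] (r : ℕ) {ι : Type} [Fintype ι] (a : ι → ℤ) : Gr k r where
  carrier := ι → Alg k r
  deg n := Submodule.pi Set.univ fun i => component k r (n - a i)
  isInternal := by
    classical
    let B : Gr k r :=
      { carrier := Alg k r
        deg := component k r
        isInternal := isInternal_component
        smul_mem := mul_mem_component }
    refine isInternal_of_projections _
      (fun n => LinearMap.pi fun i => B.proj (n - a i) ∘ₗ LinearMap.proj i) ?_ ?_ ?_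
    · intro n m hm h
      funext i
      have := congrFun h i
      have hi : m i ∈ B.deg (n - a i) := hm i trivial
      simpa [proj_of_mem hi] using this
    · intro n j hj m hm
      funext i
      have hi : m i ∈ B.deg (j - a i) := hm i trivial
      exact proj_of_mem_of_ne (by omega) hi
    · rw [eq_top_iff]
      rintro m -
      rw [← Finset.univ_sum_single m]
      refine sum_mem fun i _ => ?_
      generalize m i = b
      change B.carrier at b
      induction b using homogeneous_induction with
      | zero => rw [Pi.single_zero]; exact zero_mem _
      | add a b ha hb => rw [Pi.single_add]; exact add_mem ha hb
      | mem n b hb =>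
        refine Submodule.mem_iSup_of_mem (n + a i) fun j _ => ?_
        by_cases h : j = i
        · subst h; simpa using hb
        · simp [h]
  smul_mem := by
    intro n j b m hb hm i _
    have := mul_mem_component hb (hm i trivial)
    rwa [← add_sub_assoc] at this

variable {ι : Type} [Fintype ι] {a : ι → ℤ} {M N : Gr k r}

/-- The morphism from a graded free module given by homogeneous elements. -/
noncomputable def freeDesc (g : ι → M.carrier) (hg : ∀ i, g i ∈ M.deg (a i)) :
    Gr.Hom (free k r a) M where
  lin := Fintype.linearCombination (Alg k r) g
  map_mem := by
    intro n m hm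
    rw [Fintype.linearCombination_apply]
    refine sum_mem fun i _ => ?_
    have := M.smul_mem (hm i trivial) (hg i)
    rwa [sub_add_cancel] at this

theorem freeDesc_apply (g : ι → M.carrier) (hg : ∀ i, g i ∈ M.deg (a i))
    (b : ι → Alg k r) : (freeDesc g hg).lin b = ∑ i, b i • g i :=
  Fintype.linearCombination_apply _ _ _

theorem single_mem_free [DecidableEq ι] (i : ι) :
    (Pi.single i 1 : ι → Alg k r) ∈ (free k r a).deg (a i) := by
  intro j _
  by_cases h : j = i
  · subst h; simpa using one_mem_component
  · simp [h]

theorem free_hom_ext [DecidableEq ι] {f g : Gr.Hom (free k r a) M}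
    (h : ∀ i, f.lin (Pi.single i 1 : ι → Alg k r) = g.lin (Pi.single i 1 : ι → Alg k r)) :
    f = g := by
  refine Gr.Hom.ext (LinearMap.ext fun (x : ι → Alg k r) => ?_)
  have hx : x = ∑ i, x i • (Pi.single i 1 : ι → Alg k r) := by
    funext j
    simp [Finset.sum_apply, Pi.single_apply]
  rw [hx, map_sum, map_sum]
  simp only [map_smul, h]

/-- Graded free modules are projective. -/
theorem exists_lift_free (s : M ⟶ N) (h : free k r a ⟶ N)
    (hs : LinearMap.range (Gr.Hom.lin h) ≤ LinearMap.range (Gr.Hom.lin s)) :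
    ∃ h' : free k r a ⟶ M, h' ≫ s = h := by
  classical
  choose g hg hg' using fun i => Gr.Hom.exists_homogeneous_preimage s
    (Gr.Hom.map_mem h (single_mem_free i)) (hs ⟨(Pi.single i 1 : ι → Alg k r), rfl⟩)
  refine ⟨freeDesc g hg, free_hom_ext fun i => ?_⟩
  rw [← hg' i]
  change Gr.Hom.lin s ((freeDesc g hg).lin _) = _
  rw [freeDesc_apply]
  simp [Pi.single_apply]

/-- This is how the freedom to place generators in large degrees is used: it forces a morphism into
a prescribed submodule. -/
theorem range_le_of_free (f : Gr.Hom (free k r a) M) {S : Submodule (Alg k r) M.carrier} {N : ℤ}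
    (ha : ∀ i, N ≤ a i) (hS : ∀ j, N ≤ j → ∀ m ∈ M.deg j, m ∈ S) :
    LinearMap.range f.lin ≤ S := by
  classical
  rintro _ ⟨x, rfl⟩
  change ι → Alg k r at x
  have hx : x = ∑ i, x i • (Pi.single i 1 : ι → Alg k r) := by
    funext j
    simp [Finset.sum_apply, Pi.single_apply]
  rw [hx, map_sum]
  refine sum_mem fun i _ => ?_
  rw [map_smul]
  exact S.smul_mem _ (hS _ (ha i) _ (f.map_mem (single_mem_free i)))

end Constructions

end Gr

/-! ### Torsion modules and submodules with torsion quotient. -/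

namespace Gr

section Torsion

variable {M N : Gr k r}

/-- For i ≥ n one has B_i = B_{i-n} B_n. -/
theorem smul_mem_of_le {S : Submodule (Alg k r) M.carrier} {m : M.carrier} {n : ℕ}
    (h : ∀ b ∈ component k r n, b • m ∈ S) {i : ℤ} (hi : n ≤ i) {b : Alg k r}
    (hb : b ∈ component k r i) : b • m ∈ S := by
  obtain ⟨l, rfl⟩ := Int.exists_add_of_le hi
  rw [← Nat.cast_add, component_natCast, add_comm, pow_add] at hb
  induction hb using Submodule.mul_induction_on' with
  | mem_mul_mem a _ c hc => rw [mul_smul]; exact S.smul_mem _ (h c hc)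
  | add a _ b _ ha hb => rw [add_smul]; exact add_mem ha hb

/-- The orbit map of an element as a `k`-linear map. -/
def orbit (M : Gr k r) (m : M.carrier) : Alg k r →ₗ[k] M.carrier :=
  (LinearMap.toSpanSingleton (Alg k r) M.carrier m).restrictScalars k

theorem exists_fg_of_smul_mem {S : Submodule (Alg k r) M.carrier} {m : M.carrier} {n : ℕ}
    (h : ∀ b ∈ component k r n, b • m ∈ S) :
    ∃ V : Submodule k M.carrier, V.FG ∧ ∀ b : Alg k r, b • m ∈ V ⊔ S.restrictScalars k := by
  refine ⟨⨆ i : Fin n, (component k r i).map (M.orbit m), ?_, fun b => ?_⟩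
  · refine Submodule.fg_iSup _ fun i => Submodule.FG.map _ ?_
    exact Module.Finite.iff_fg.1 (finite_component i)
  · have hb : b ∈ ⨆ i, component k r i := iSup_component (k := k) ▸ Submodule.mem_top
    induction hb using Submodule.iSup_induction' with
    | zero => rw [zero_smul]; exact zero_mem _
    | add a b _ _ ha hb => rw [add_smul]; exact add_mem ha hb
    | mem i b hb =>
      rcases le_or_gt (n : ℤ) i with hi | hi
      · exact Submodule.mem_sup_right (smul_mem_of_le h hi hb)
      rcases lt_or_ge i 0 with h0 | h0
      · rw [component_of_neg h0, Submodule.mem_bot] at hb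
        rw [hb, zero_smul]; exact zero_mem _
      lift i to ℕ using h0
      exact Submodule.mem_sup_left <| Submodule.mem_iSup_of_mem ⟨i, by exact_mod_cast hi⟩
        ⟨b, hb, rfl⟩

/-- If b_n m ≠ 0 for some b_n in every B_n, these elements have distinct degrees and are independent
in a finite dimensional submodule, which is absurd. Conversely, an element killed by B_n is killed
by all later components, so B m is spanned by the B_i m with i < n. -/
theorem isUnionFinDim_iff :
    IsUnionFinDim k r M.carrier ↔
      ∀ j, ∀ m ∈ M.deg j, ∃ n : ℕ, ∀ b ∈ component k r n, b • m = 0 := by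
  constructor
  · intro h j m hm
    obtain ⟨P, hP, hfin⟩ := h m
    by_contra! hne
    choose b hb hbm using hne
    have hind : iSupIndep fun n : ℕ => M.deg (n + j) :=
      M.isInternal.submodule_iSupIndep.comp fun a b h => by simpa using h
    have hli : LinearIndependent k fun n => b n • m :=
      hind.linearIndependent _ (fun n => M.smul_mem (hb n) hm) hbm
    have hli' : LinearIndependent k fun n => (⟨b n • m, P.smul_mem _ hP⟩ : P) :=
      LinearIndependent.of_comp (P.subtype.restrictScalars k) hli
    exact not_finite_iff_infinite.2 (inferInstanceAs (Infinite ℕ)) hli'.finite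
  · intro h m
    induction m using homogeneous_induction with
    | zero => exact ⟨⊥, zero_mem _, inferInstance⟩
    | add a b ha hb =>
      obtain ⟨P, hP, hPf⟩ := ha
      obtain ⟨Q, hQ, hQf⟩ := hb
      refine ⟨P ⊔ Q, add_mem (Submodule.mem_sup_left hP) (Submodule.mem_sup_right hQ), ?_⟩
      have hP' : Module.Finite k (P.restrictScalars k) := hPf
      have hQ' : Module.Finite k (Q.restrictScalars k) := hQf
      have : Module.Finite k ((P ⊔ Q).restrictScalars k) := by
        rw [Submodule.restrictScalars_sup]
        infer_instance
      exact this
    | mem j m hm =>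
      obtain ⟨n, hn⟩ := h j m hm
      obtain ⟨V, hV, hVm⟩ := exists_fg_of_smul_mem (S := ⊥) hn
      refine ⟨Submodule.span _ {m}, Submodule.mem_span_singleton_self m, ?_⟩
      have : Module.Finite k V := Module.Finite.iff_fg.2 hV
      have hle : (Submodule.span (Alg k r) {m}).restrictScalars k ≤ V := by
        intro z hz
        obtain ⟨b, rfl⟩ := Submodule.mem_span_singleton.1 hz
        simpa using hVm b
      have : Module.Finite k ((Submodule.span (Alg k r) {m}).restrictScalars k) :=
        Submodule.finiteDimensional_of_le hle
      exact this

/-- A submodule `S` of `M` such that `M / S` is torsion. -/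
def IsCotorsion (M : Gr k r) (S : Submodule (Alg k r) M.carrier) : Prop :=
  ∀ j, ∀ m ∈ M.deg j, ∃ n : ℕ, ∀ b ∈ component k r n, b • m ∈ S

theorem isUnionFinDim_quotient_iff {S : Submodule (Alg k r) M.carrier} (hS : M.IsHomogeneous S) :
    IsUnionFinDim k r (M.carrier ⧸ S) ↔ M.IsCotorsion S := by
  refine (isUnionFinDim_iff (M := M.quot S hS)).trans ⟨fun h j m hm => ?_, ?_⟩
  · obtain ⟨n, hn⟩ := h j (Submodule.Quotient.mk m) ⟨m, hm, rfl⟩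
    refine ⟨n, fun b hb => ?_⟩
    have := hn b hb
    rwa [← Submodule.Quotient.mk_smul, Submodule.Quotient.mk_eq_zero] at this
  · rintro h j _ ⟨m, hm, rfl⟩
    obtain ⟨n, hn⟩ := h j m hm
    refine ⟨n, fun b hb => ?_⟩
    exact (Submodule.Quotient.mk_eq_zero S).2 (hn b hb)

theorem isUnionFinDim_sub_iff {S : Submodule (Alg k r) M.carrier} (hS : M.IsHomogeneous S) :
    IsUnionFinDim k r S ↔
      ∀ j, ∀ m ∈ M.deg j, m ∈ S → ∃ n : ℕ, ∀ b ∈ component k r n, b • m = 0 := by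
  refine (isUnionFinDim_iff (M := M.sub S hS)).trans ⟨fun h j m hm hmS => ?_, fun h j m hm => ?_⟩
  · obtain ⟨n, hn⟩ := h j ⟨m, hmS⟩ hm
    exact ⟨n, fun b hb => congrArg Subtype.val (hn b hb)⟩
  · obtain ⟨n, hn⟩ := h j m.1 hm m.2
    exact ⟨n, fun b hb => Subtype.ext (hn b hb)⟩

theorem isUnionFinDim_of_finite {T : Type u} [AddCommGroup T] [Module k T] [Module (Alg k r) T]
    [IsScalarTower k (Alg k r) T] [h : Module.Finite k T] : IsUnionFinDim k r T := fun m =>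
  ⟨⊤, Submodule.mem_top, by
    have : Module.Finite k ((⊤ : Submodule (Alg k r) T).restrictScalars k) := by
      rw [Submodule.restrictScalars_top]; infer_instance
    exact this⟩

end Torsion

/-! ### Finitely generated modules and tameness in large degrees. -/

section FiniteGeneration

variable {M N : Gr k r}

/-- Each generator is replaced by its finitely many homogeneous components. -/
theorem exists_free_surjective (M : Gr k r) [Module.Finite (Alg k r) M.carrier] :
    ∃ (ι : Type) (_ : Fintype ι) (a : ι → ℤ) (g : ι → M.carrier) (hg : ∀ i, g i ∈ M.deg (a i)),
      Function.Surjective (freeDesc g hg).lin := by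
  obtain ⟨n, s, hs⟩ := Module.Finite.exists_fin (R := Alg k r) (M := M.carrier)
  choose t ht ht' using fun i => exists_sum_proj (s i)
  refine ⟨Σ i : Fin n, t i, inferInstance, fun i => i.2, fun i => M.proj i.2 (s i.1),
    fun i => proj_mem _ _, ?_⟩
  rw [← LinearMap.range_eq_top, eq_top_iff, ← hs, Submodule.span_le]
  rintro _ ⟨i, rfl⟩
  rw [ht' i]
  refine sum_mem fun j hj => ?_
  classical
  refine ⟨(Pi.single ⟨i, j, hj⟩ 1 : (Σ i : Fin n, t i) → Alg k r), ?_⟩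
  rw [freeDesc_apply]
  simp [Pi.single_apply]

/-- A submodule with torsion quotient contains all elements of large degree. -/
theorem IsCotorsion.exists_deg_le [Module.Finite (Alg k r) M.carrier]
    {S : Submodule (Alg k r) M.carrier} (hS : M.IsCotorsion S) :
    ∃ N : ℤ, ∀ j, N ≤ j → ∀ m ∈ M.deg j, m ∈ S := by
  obtain ⟨ι, _, a, g, hg, hsurj⟩ := exists_free_surjective M
  choose n hn using fun i => hS _ _ (hg i)
  -- In degree at least a i + n i, the i-th coefficient has degree at least n i and so carries g i
  -- into S.
  obtain ⟨N, hN⟩ := (Set.finite_range fun i => a i + n i).bddAbove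
  refine ⟨N, fun j hj m hm => ?_⟩
  obtain ⟨f, hf, rfl⟩ := (freeDesc g hg).exists_homogeneous_preimage hm (hsurj m)
  rw [freeDesc_apply]
  refine sum_mem fun i _ => smul_mem_of_le (hn i) ?_ (hf i trivial)
  have := hN ⟨i, rfl⟩
  simp only at this
  omega

theorem finite_deg [Module.Finite (Alg k r) M.carrier] (n : ℤ) : Module.Finite k (M.deg n) := by
  obtain ⟨ι, _, a, g, hg, hsurj⟩ := exists_free_surjective M
  have := fun i => finite_component (k := k) (r := r) (n - a i)
  have hfin : Module.Finite k (⨆ i, (component k r (n - a i)).map (M.orbit (g i)) :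
      Submodule k M.carrier) := inferInstance
  refine Submodule.finiteDimensional_of_le (S₂ := ⨆ i, (component k r (n - a i)).map
    (M.orbit (g i))) fun m hm => ?_
  obtain ⟨f, hf, rfl⟩ := (freeDesc g hg).exists_homogeneous_preimage hm (hsurj m)
  rw [freeDesc_apply]
  exact sum_mem fun i _ => Submodule.mem_iSup_of_mem i ⟨f i, hf i trivial, rfl⟩

theorem IsCotorsion.finite_quotient [Module.Finite (Alg k r) M.carrier]
    {S : Submodule (Alg k r) M.carrier} (hS : M.IsCotorsion S) :
    Module.Finite k (M.carrier ⧸ S) := by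
  obtain ⟨ι, _, a, g, hg, hsurj⟩ := exists_free_surjective M
  choose n hn using fun i => hS _ _ (hg i)
  choose V hV hVm using fun i => exists_fg_of_smul_mem (hn i)
  have htop : (⨆ i, V i) ⊔ S.restrictScalars k = ⊤ := by
    refine Submodule.eq_top_iff'.2 fun m => ?_
    obtain ⟨f, rfl⟩ := hsurj m
    rw [freeDesc_apply]
    refine sum_mem fun i _ => ?_
    exact sup_le_sup_right (le_iSup V i) _ (hVm i _)
  have := fun i => Module.Finite.iff_fg.2 (hV i)
  refine Module.Finite.of_surjective
    ((S.mkQ.restrictScalars k) ∘ₗ (⨆ i, V i : Submodule k M.carrier).subtype) fun q => ?_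
  obtain ⟨m, rfl⟩ := S.mkQ_surjective q
  obtain ⟨v, hv, s, hs, rfl⟩ := Submodule.mem_sup.1 (htop ▸ Submodule.mem_top : m ∈ _)
  refine ⟨⟨v, hv⟩, ?_⟩
  rw [map_add, show S.mkQ s = 0 from (Submodule.Quotient.mk_eq_zero S).2 hs, add_zero]
  rfl

theorem exists_gen_smul_add_of_free {ι : Type} [Fintype ι] {a : ι → ℤ} {n : ℤ}
    (ha : ∀ i, a i ≤ n) {f : ι → Alg k r} (hf : f ∈ (free k r a).deg (n + 1)) :
    ∃ f₀ ∈ (free k r a).deg n, ∃ f₁ ∈ (free k r a).deg n,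
      f = gen k r 0 • f₀ + gen k r 1 • f₁ := by
  choose f₀ h₀ f₁ h₁ h using fun i => exists_eq_of_mem_component_add_one (n := n - a i) (b := f i)
    (by have := ha i; omega) (by rw [sub_add_eq_add_sub]; exact hf i trivial)
  exact ⟨f₀, fun i _ => h₀ i, f₁, fun i _ => h₁ i, funext h⟩

theorem eq_zero_of_gen_smul_add_of_free {ι : Type} [Fintype ι] {a : ι → ℤ} {n : ℤ}
    {f₀ f₁ : ι → Alg k r} (h : gen k r 0 • f₀ + gen k r 1 • f₁ = 0)
    (hf₁ : f₁ ∈ (free k r a).deg n) :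
    f₀ = 0 ∧ ∃ c ∈ (free k r a).deg (n - r), f₁ = gen k r 1 ^ r • c := by
  have h₀ : f₀ = 0 := funext fun i => eq_zero_of_gen_mul_add_eq_zero (congrFun h i)
  subst h₀
  choose c hc using fun i => exists_eq_pow_mul_of_gen_mul_eq_zero (b := f₁ i) (by
    simpa using congrFun h i)
  -- The c chosen coordinatewise need not be homogeneous; its component of degree n - r serves as
  -- well, since f₁ is homogeneous of degree n.
  refine ⟨rfl, (free k r a).proj (n - r) c, proj_mem _ _, ?_⟩
  have hc' : f₁ = gen k r 1 ^ r • c := funext hc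
  rw [← proj_smul (pow_mem_component (gen_mem 1) r), ← hc']
  rw [show (r : ℤ) + (n - r) = n by ring, proj_of_mem hf₁]

/-- In large degrees, a finitely presented module is generated in the lowest degree with relations
only those coming from `y ^ (r + 1) = 0`. -/
structure IsTame (M : Gr k r) (n₀ : ℤ) : Prop where
  exists_eq : ∀ n, n₀ ≤ n → ∀ m ∈ M.deg (n + 1), ∃ m₀ ∈ M.deg n, ∃ m₁ ∈ M.deg n,
    m = gen k r 0 • m₀ + gen k r 1 • m₁
  eq_zero : ∀ n, n₀ ≤ n → ∀ m₀ ∈ M.deg n, ∀ m₁ ∈ M.deg n,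
    gen k r 0 • m₀ + gen k r 1 • m₁ = 0 →
      m₀ = 0 ∧ ∃ c ∈ M.deg (n - r), m₁ = gen k r 1 ^ r • c

theorem exists_eq_of_surjective {ι : Type} [Fintype ι] {a : ι → ℤ} (f : free k r a ⟶ M)
    (hf : Function.Surjective (Gr.Hom.lin f)) {n : ℤ} (ha : ∀ i, a i ≤ n) {m : M.carrier}
    (hm : m ∈ M.deg (n + 1)) : ∃ m₀ ∈ M.deg n, ∃ m₁ ∈ M.deg n,
      m = gen k r 0 • m₀ + gen k r 1 • m₁ := by
  obtain ⟨z, hz, rfl⟩ := Gr.Hom.exists_homogeneous_preimage f hm (hf m)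
  obtain ⟨z₀, h₀, z₁, h₁, rfl⟩ := exists_gen_smul_add_of_free ha hz
  exact ⟨_, Gr.Hom.map_mem f h₀, _, Gr.Hom.map_mem f h₁, by
    rw [map_add (Gr.Hom.lin f), map_smul (Gr.Hom.lin f), map_smul (Gr.Hom.lin f)]⟩

/-- The relation module K of a free cover is finitely generated, so K_{n+1} = x K_n + y K_n in large
degrees. A relation x m₀ + y m₁ = 0 in M, lifted to the cover, can therefore be corrected by
elements of K to a relation in the free module. -/
theorem exists_isTame (M : Gr k r) [Module.FinitePresentation (Alg k r) M.carrier] :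
    ∃ n₀, ∀ n, n₀ ≤ n → M.IsTame n := by
  obtain ⟨ι, _, a, g, hg, hsurj⟩ := exists_free_surjective M
  set f := freeDesc g hg
  have hK := f.isHomogeneous_ker
  have : Module.Finite (Alg k r) ((free k r a).sub _ hK).carrier :=
    Module.Finite.iff_fg.2 (Module.FinitePresentation.fg_ker f.lin hsurj)
  obtain ⟨κ, _, b, g', hg', hsurj'⟩ := exists_free_surjective ((free k r a).sub _ hK)
  obtain ⟨A, hA⟩ := (Set.finite_range a).bddAbove
  obtain ⟨A', hA'⟩ := (Set.finite_range b).bddAbove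
  refine ⟨max A A', fun n₀ hn₀ => ⟨fun n hn m hm =>
    exists_eq_of_surjective f hsurj (fun i => by have := hA ⟨i, rfl⟩; omega) hm, ?_⟩⟩
  intro n hn m₀ h₀ m₁ h₁ h
  obtain ⟨z₀, hz₀, rfl⟩ := f.exists_homogeneous_preimage h₀ (hsurj m₀)
  obtain ⟨z₁, hz₁, rfl⟩ := f.exists_homogeneous_preimage h₁ (hsurj m₁)
  have hz : gen k r 0 • z₀ + gen k r 1 • z₁ ∈ LinearMap.ker f.lin := by
    rw [LinearMap.mem_ker, map_add, map_smul, map_smul, h]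
  have hz' : gen k r 0 • z₀ + gen k r 1 • z₁ ∈ (free k r a).deg (n + 1) := by
    rw [add_comm n]
    exact add_mem ((free k r a).smul_mem (gen_mem 0) hz₀) ((free k r a).smul_mem (gen_mem 1) hz₁)
  obtain ⟨u, hu, v, hv, huv⟩ := exists_eq_of_surjective (n := n) (freeDesc g' hg') hsurj'
    (fun i => by have := hA' ⟨i, rfl⟩; omega) (m := ⟨_, hz⟩) hz'
  have huv' := congrArg Subtype.val huv
  change gen k r 0 • z₀ + gen k r 1 • z₁ = gen k r 0 • u.1 + gen k r 1 • v.1 at huv'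
  obtain ⟨e₀, c, hc, e₁⟩ := eq_zero_of_gen_smul_add_of_free (f₀ := z₀ - u.1) (f₁ := z₁ - v.1)
    (n := n) (a := a) (by rw [smul_sub, smul_sub, ← sub_eq_zero.2 huv']; abel) (sub_mem hz₁ hv)
  have hu0 : f.lin u.1 = 0 := u.2
  have hv0 : f.lin v.1 = 0 := v.2
  refine ⟨?_, f.lin c, f.map_mem hc, ?_⟩
  · rw [sub_eq_zero.1 e₀, hu0]
  · rw [← map_smul, ← e₁, map_sub, hv0, sub_zero]

end FiniteGeneration

end Gr

/-! ### Finitely presented modules are free up to finite dimension. -/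

theorem gen_one_pow_eq_zero {n : ℕ} (hn : r < n) : gen k r 1 ^ n = 0 := by
  obtain ⟨l, rfl⟩ := Nat.exists_eq_add_of_lt hn
  rw [show r + l + 1 = r + 1 + l by ring, pow_add, gen_one_pow, zero_mul]

theorem exists_eq_algebraMap_add {t j : ℕ} {b : Alg k r}
    (hb : b ∈ component k r ((t : ℤ) - j)) :
    ∃ c : k, (j ≠ t → c = 0) ∧ ∃ b₀ ∈ component k r ((t : ℤ) - 1 - j),
      ∃ b₁ ∈ component k r ((t : ℤ) - 1 - j),
        b = algebraMap k _ c + gen k r 0 * b₀ + gen k r 1 * b₁ := by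
  by_cases h : j = t
  · subst h
    rw [sub_self, component_zero, Submodule.mem_one] at hb
    obtain ⟨c, rfl⟩ := hb
    exact ⟨c, fun h => absurd rfl h, 0, zero_mem _, 0, zero_mem _, by simp⟩
  · obtain ⟨b₀, h₀, b₁, h₁, e⟩ := exists_eq_of_mem_component_add_one (n := (t : ℤ) - 1 - j)
      (by omega) (b := b) (by rwa [show (t : ℤ) - 1 - j + 1 = t - j by ring])
    exact ⟨0, fun _ => rfl, b₀, h₀, b₁, h₁, by simpa using e⟩

namespace Gr

theorem mem_deg_free {ι : Type} [Fintype ι] {a : ι → ℤ} {n : ℤ} {f : ι → Alg k r} :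
    f ∈ (free k r a).deg n ↔ ∀ i, f i ∈ component k r (n - a i) :=
  ⟨fun h i => h i trivial, fun h i _ => h i⟩

theorem mem_deg_free_shift {ι : Type} [Fintype ι] {m : ℤ} {j : ι → ℕ} {t : ℤ}
    {f : ι → Alg k r} : f ∈ (free k r fun i => m + 1 + j i).deg (m + t) ↔
      ∀ i, f i ∈ component k r (t - 1 - j i) := by
  rw [mem_deg_free]
  refine forall_congr' fun i => ?_
  rw [show m + t - (m + 1 + j i) = t - 1 - j i by ring]

/-- A family consisting of bases of the spaces `y ^ j M_m`, `0 ≤ j ≤ r`. -/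
structure IsBasisFamily (M : Gr k r) (m : ℤ) {ι : Type} [Fintype ι] (w : ι → M.carrier)
    (j : ι → ℕ) : Prop where
  exists_eq_smul : ∀ i, ∃ u ∈ M.deg m, w i = gen k r 1 ^ j i • u
  exists_sum : ∀ t ≤ r, ∀ u ∈ M.deg m, ∃ c : ι → k, (∀ i, j i ≠ t → c i = 0) ∧
    gen k r 1 ^ t • u = ∑ i, c i • w i
  eq_zero : ∀ t (c : ι → k), (∀ i, j i ≠ t → c i = 0) → ∑ i, c i • w i = 0 → c = 0

theorem exists_isBasisFamily (M : Gr k r) (m : ℤ) [Module.Finite k (M.deg m)] :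
    ∃ (ι : Type) (_ : Fintype ι) (w : ι → M.carrier) (j : ι → ℕ), M.IsBasisFamily m w j := by
  let Y (t : ℕ) : Submodule k M.carrier :=
    (M.deg m).map (Algebra.lsmul k k M.carrier (gen k r 1 ^ t))
  have (t : ℕ) : Module.Finite k (Y t) := inferInstance
  let b (t : ℕ) := Module.finBasis k (Y t)
  refine ⟨Σ t : Fin (r + 1), Fin (Module.finrank k (Y t)), inferInstance,
    fun i => (b i.1 i.2 : M.carrier), fun i => i.1, ⟨fun i => ?_, fun t ht u hu => ?_, ?_⟩⟩
  · obtain ⟨u, hu, h⟩ := (b i.1 i.2).2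
    exact ⟨u, hu, h.symm⟩
  · let y : Y t := ⟨gen k r 1 ^ t • u, u, hu, rfl⟩
    let t' : Fin (r + 1) := ⟨t, by omega⟩
    refine ⟨fun i => if h : i.1 = t' then (b t).repr y (Fin.cast (by rw [h]) i.2) else 0,
      fun i hi => dif_neg fun h => hi (by rw [h]), ?_⟩
    rw [Fintype.sum_sigma, Finset.sum_eq_single t']
    · have := congrArg Subtype.val ((b t).sum_repr y)
      simp only [dite_true, Fin.cast_eq_self]
      rw [show gen k r 1 ^ t • u = (y : M.carrier) from rfl, ← this,
        AddSubmonoidClass.coe_finsetSum]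
      rfl
    · intro s _ hs
      refine Finset.sum_eq_zero fun i _ => ?_
      dsimp only
      rw [dif_neg hs, zero_smul]
    · simp
  · intro t c hc h
    funext ⟨s, i⟩
    by_cases hs : (s : ℕ) = t
    · rw [Fintype.sum_sigma, Finset.sum_eq_single s] at h
      · refine Fintype.linearIndependent_iff.1 (b s).linearIndependent (fun i => c ⟨s, i⟩) ?_ i
        apply Subtype.ext
        rw [AddSubmonoidClass.coe_finsetSum]
        exact h
      · intro s' _ hs'
        refine Finset.sum_eq_zero fun i _ => ?_
        rw [hc ⟨s', i⟩ fun h => hs' (Fin.ext (h.trans hs.symm)), zero_smul]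
      · simp
    · exact hc _ hs

namespace IsBasisFamily

variable {M : Gr k r} {m : ℤ} {ι : Type} [Fintype ι] {w : ι → M.carrier} {j : ι → ℕ}

theorem gen_smul_mem (h : M.IsBasisFamily m w j) (i : ι) :
    gen k r 0 • w i ∈ M.deg (m + 1 + j i) := by
  obtain ⟨u, hu, e⟩ := h.exists_eq_smul i
  rw [e, show m + 1 + j i = 1 + (j i + m) by ring]
  exact M.smul_mem (gen_mem 0) (M.smul_mem (pow_mem_component (gen_mem 1) _) hu)

/-- The elements `x wᵢ` of a basis family define a morphism from a graded free module. -/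
noncomputable def hom (h : M.IsBasisFamily m w j) :
    Gr.Hom (free k r fun i => m + 1 + j i) M :=
  freeDesc (fun i => gen k r 0 • w i) h.gen_smul_mem

theorem hom_apply (h : M.IsBasisFamily m w j) (f : ι → Alg k r) :
    h.hom.lin f = ∑ i, f i • gen k r 0 • w i :=
  freeDesc_apply _ _ _

/-- In the inductive step x y^t u₀ is a combination of the x wᵢ with j i = t, or zero when t > r,
and y y^t u₁ already has the required form. -/
theorem exists_eq_hom_add (h : M.IsBasisFamily m w j) (hM : M.IsTame m) (t : ℕ) :
    ∀ z ∈ M.deg (m + t), ∃ f ∈ (free k r fun i => m + 1 + j i).deg (m + t), ∃ u ∈ M.deg m,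
      z = h.hom.lin f + gen k r 1 ^ t • u := by
  induction t with
  | zero =>
    intro z hz
    exact ⟨0, zero_mem _, z, by simpa using hz, by simp⟩
  | succ t ih =>
    intro z hz
    rw [Nat.cast_succ, ← add_assoc] at hz
    obtain ⟨z₀, h₀, z₁, h₁, rfl⟩ := hM.exists_eq (m + t) (by omega) z hz
    obtain ⟨f₀, hf₀, u₀, hu₀, rfl⟩ := ih z₀ h₀
    obtain ⟨f₁, hf₁, u₁, hu₁, rfl⟩ := ih z₁ h₁
    have key : ∃ f ∈ (free k r fun i => m + 1 + j i).deg (m + (t + 1 : ℕ)),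
        gen k r 0 • gen k r 1 ^ t • u₀ = h.hom.lin f := by
      by_cases ht : t ≤ r
      · obtain ⟨c, hc, e⟩ := h.exists_sum t ht u₀ hu₀
        refine ⟨fun i => algebraMap k _ (c i), mem_deg_free_shift.2 fun i => ?_, ?_⟩
        · by_cases hi : j i = t
          · rw [hi, show ((t + 1 : ℕ) : ℤ) - 1 - t = 0 by push_cast; ring]
            exact algebraMap_mem (c i)
          · simp [hc i hi]
        · rw [hom_apply, e, Finset.smul_sum]
          refine Finset.sum_congr rfl fun i _ => ?_
          rw [← algebraMap_smul (Alg k r) (c i), ← mul_smul, ← mul_smul, Algebra.commutes]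
      · exact ⟨0, zero_mem _, by rw [gen_one_pow_eq_zero (by omega)]; simp⟩
    obtain ⟨f, hf, e⟩ := key
    have hd : m + (t + 1 : ℕ) = 1 + (m + t) := by push_cast; ring
    refine ⟨gen k r 0 • f₀ + gen k r 1 • f₁ + f, ?_, u₁, hu₁, ?_⟩
    · refine add_mem (add_mem ?_ ?_) hf
      · rw [hd]; exact (free k r fun i => m + 1 + j i).smul_mem (gen_mem 0) hf₀
      · rw [hd]; exact (free k r fun i => m + 1 + j i).smul_mem (gen_mem 1) hf₁
    · rw [smul_add, e, smul_add, ← mul_smul, ← pow_succ', map_add, map_add, map_smul, map_smul]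
      abel

/-- Injectivity in degree m + t and independence from y^t M_m must be proved together, because
separating the x-part from the y-part of a relation leaves a tail in y^t M_m. For t = 0 there is
nothing to prove: all generators have degree at least m + 1. -/
theorem eq_zero_of_hom_eq (h : M.IsBasisFamily m w j) (hM : M.IsTame m) (t : ℕ) :
    ∀ f ∈ (free k r fun i => m + 1 + j i).deg (m + t), ∀ u ∈ M.deg m,
      h.hom.lin f = gen k r 1 ^ t • u → f = 0 := by
  induction t with
  | zero =>
    intro f hf u _ _
    funext i
    have := mem_deg_free_shift.1 hf i
    rw [component_of_neg (by push_cast; omega)] at this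
    exact this
  | succ t ih =>
    intro f hf u hu hfu
    -- In degree m + t + 1 a constant coefficient can occur only at the generators x wᵢ with j i =
    -- t.
    choose c hc f₀ hf₀ f₁ hf₁ e using fun i => exists_eq_algebraMap_add (t := t) (j := j i)
      (b := f i) (by
        have := mem_deg_free_shift.1 hf i
        rwa [show ((t + 1 : ℕ) : ℤ) - 1 - j i = t - j i by push_cast; ring] at this)
    choose u' hu' hw using h.exists_eq_smul
    have hF₀ : f₀ ∈ (free k r fun i => m + 1 + j i).deg (m + t) := mem_deg_free_shift.2 hf₀
    have hF₁ : f₁ ∈ (free k r fun i => m + 1 + j i).deg (m + t) := mem_deg_free_shift.2 hf₁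
    set v := ∑ i, c i • u' i with hv
    have hvm : v ∈ M.deg m := sum_mem fun i _ => Submodule.smul_mem _ _ (hu' i)
    have hvw : ∑ i, c i • w i = gen k r 1 ^ t • v := by
      rw [hv, Finset.smul_sum]
      refine Finset.sum_congr rfl fun i _ => ?_
      by_cases hi : j i = t
      · rw [hw i, hi, smul_comm]
      · simp [hc i hi]
    have hpow (x : M.carrier) (hx : x ∈ M.deg m) : gen k r 1 ^ t • x ∈ M.deg (m + t) := by
      rw [add_comm]
      exact M.smul_mem (pow_mem_component (gen_mem 1) t) hx
    have hf' : f = (fun i => algebraMap k _ (c i)) + gen k r 0 • f₀ + gen k r 1 • f₁ := funext e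
    have hsum : h.hom.lin f = gen k r 0 • (gen k r 1 ^ t • v + h.hom.lin f₀) +
        gen k r 1 • h.hom.lin f₁ := by
      rw [hf', map_add, map_add, map_smul, map_smul, ← hvw, smul_add]
      congr 2
      rw [hom_apply, Finset.smul_sum]
      refine Finset.sum_congr rfl fun i _ => ?_
      rw [← algebraMap_smul (Alg k r) (c i) (w i), ← mul_smul, ← mul_smul, Algebra.commutes]
    have hrel : gen k r 0 • (gen k r 1 ^ t • v + h.hom.lin f₀) +
        gen k r 1 • (h.hom.lin f₁ - gen k r 1 ^ t • u) = 0 := by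
      rw [smul_sub, ← mul_smul (gen k r 1), ← pow_succ', ← hfu, hsum]
      abel
    obtain ⟨e₀, z, hz, e₁⟩ := hM.eq_zero (m + t) (by omega) _
      (add_mem (hpow v hvm) (h.hom.map_mem hF₀)) _
      (sub_mem (h.hom.map_mem hF₁) (hpow u hu)) hrel
    have hf₀0 : f₀ = 0 := ih f₀ hF₀ (-v) (neg_mem hvm) (by
      rw [smul_neg, eq_neg_iff_add_eq_zero, add_comm, e₀])
    have hc0 : c = 0 := h.eq_zero t c hc (by rw [hvw]; simpa [hf₀0] using e₀)
    have hf₁0 : gen k r 1 • f₁ = 0 := by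
      rcases le_or_gt t r with ht | ht
      -- Here y^r z = y^t (y^(r-t) z) with y^(r-t) z in M_m, so the induction hypothesis gives f₁ =
      -- 0.
      · rw [ih f₁ hF₁ (u + gen k r 1 ^ (r - t) • z) (add_mem hu ?_) ?_, smul_zero]
        · have := M.smul_mem (pow_mem_component (gen_mem 1) (r - t)) hz
          rwa [show ((r - t : ℕ) : ℤ) + (m + t - r) = m by omega] at this
        · rw [smul_add, ← mul_smul, ← pow_add, Nat.add_sub_cancel' ht, ← e₁]
          abel
      -- Here y^t = 0, so y^r z is the image of y^r g. The induction hypothesis gives f₁ = y^r g,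
      -- which y kills.
      · obtain ⟨g, hg, u₂, -, rfl⟩ := h.exists_eq_hom_add hM (t - r) z (by
          rwa [show m + ((t - r : ℕ) : ℤ) = m + t - r by omega])
        have := ih (f₁ - gen k r 1 ^ r • g) (sub_mem hF₁ ?_) 0 (zero_mem _) ?_
        · rw [sub_eq_zero.1 this, ← mul_smul, ← pow_succ', gen_one_pow, zero_smul]
        · have := (free k r fun i => m + 1 + j i).smul_mem
            (pow_mem_component (gen_mem 1) r) hg
          rwa [show (r : ℤ) + (m + ((t - r : ℕ) : ℤ)) = m + t by omega] at this
        · rw [smul_add, ← mul_smul, ← pow_add, gen_one_pow_eq_zero (n := r + (t - r)) (by omega),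
            gen_one_pow_eq_zero ht] at e₁
          rw [map_sub, map_smul]
          simpa [sub_eq_zero] using e₁
    rw [hf', hc0, hf₀0, hf₁0]
    funext i
    simp
    rfl

theorem hom_injective (h : M.IsBasisFamily m w j) (hM : M.IsTame m) :
    Function.Injective h.hom.lin := by
  rw [injective_iff_map_eq_zero]
  intro f hf
  obtain ⟨s, -, e⟩ := exists_sum_proj f
  rw [e]
  refine Finset.sum_eq_zero fun n _ => ?_
  have hn : h.hom.lin ((free k r fun i => m + 1 + j i).proj n f) = 0 := by
    rw [h.hom.map_proj, hf, map_zero]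
  have hmem := proj_mem (M := free k r fun i => m + 1 + j i) n f
  rcases lt_or_ge n m with hnm | hnm
  · funext i
    have := mem_deg_free.1 hmem i
    rw [component_of_neg (by omega)] at this
    exact this
  · obtain ⟨t, rfl⟩ := Int.exists_add_of_le hnm
    exact h.eq_zero_of_hom_eq hM t _ hmem 0 (zero_mem _) (by rw [hn, smul_zero])

theorem isCotorsion_range_hom (h : M.IsBasisFamily m w j) (hM : M.IsTame m) :
    M.IsCotorsion (LinearMap.range h.hom.lin) := by
  intro n z hz
  -- This moves z to a degree at least m + r + 1, where the summand y^t M_m has disappeared.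
  refine ⟨(m + r + 1 - n).toNat, fun b hb => ?_⟩
  have hbz := M.smul_mem hb hz
  obtain ⟨t, ht⟩ := Int.exists_add_of_le
    (show m + r + 1 ≤ ((m + r + 1 - n).toNat : ℤ) + n by omega)
  obtain ⟨f, -, u, -, e⟩ := h.exists_eq_hom_add hM (r + 1 + t) (b • z) (by
    rw [ht] at hbz
    convert hbz using 2
    push_cast; ring)
  rw [e, gen_one_pow_eq_zero (by omega), zero_smul, add_zero]
  exact ⟨f, rfl⟩

end IsBasisFamily

/-- Up to finite dimensional modules, finitely presented graded modules are free, with generators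
in arbitrarily large degrees. -/
theorem exists_free_hom (M : Gr k r) [Module.FinitePresentation (Alg k r) M.carrier] (N : ℤ) :
    ∃ (ι : Type) (_ : Fintype ι) (a : ι → ℤ) (f : free k r a ⟶ M), (∀ i, N ≤ a i) ∧
      Function.Injective (Gr.Hom.lin f) ∧
      Module.Finite k (M.carrier ⧸ LinearMap.range (Gr.Hom.lin f)) := by
  obtain ⟨n₀, h₀⟩ := exists_isTame M
  set m := max n₀ N
  have hM := h₀ m (le_max_left _ _)
  have := finite_deg (M := M) m
  obtain ⟨ι, _, w, j, h⟩ := exists_isBasisFamily M m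
  exact ⟨ι, inferInstance, fun i => m + 1 + j i, h.hom,
    fun i => (le_max_right n₀ N).trans (by dsimp only; omega), h.hom_injective hM,
    (h.isCotorsion_range_hom hM).finite_quotient⟩

end Gr

/-! ### Additive structure and calculus of fractions on Gr B. -/

namespace Gr

section Preadditive

variable {M N P : Gr k r}

theorem comp_lin (f : M ⟶ N) (g : N ⟶ P) :
    Gr.Hom.lin (f ≫ g) = (Gr.Hom.lin g).comp (Gr.Hom.lin f) := rfl

theorem lin_injective : Function.Injective (Gr.Hom.lin : (M ⟶ N) → _) :=
  fun _ _ h => Gr.Hom.ext h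

instance : Zero (M ⟶ N) := ⟨Gr.Hom.mk 0 fun _ => zero_mem _⟩

instance : Add (M ⟶ N) :=
  ⟨fun f g => Gr.Hom.mk (Gr.Hom.lin f + Gr.Hom.lin g)
    fun h => add_mem (Gr.Hom.map_mem f h) (Gr.Hom.map_mem g h)⟩

instance : Neg (M ⟶ N) :=
  ⟨fun f => Gr.Hom.mk (-Gr.Hom.lin f) fun h => neg_mem (Gr.Hom.map_mem f h)⟩

instance : Sub (M ⟶ N) :=
  ⟨fun f g => Gr.Hom.mk (Gr.Hom.lin f - Gr.Hom.lin g)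
    fun h => sub_mem (Gr.Hom.map_mem f h) (Gr.Hom.map_mem g h)⟩

instance : SMul ℕ (M ⟶ N) :=
  ⟨fun n f => Gr.Hom.mk (n • Gr.Hom.lin f) fun h => nsmul_mem (Gr.Hom.map_mem f h) n⟩

instance : SMul ℤ (M ⟶ N) :=
  ⟨fun n f => Gr.Hom.mk (n • Gr.Hom.lin f) fun h => zsmul_mem (Gr.Hom.map_mem f h) n⟩

instance : AddCommGroup (M ⟶ N) :=
  Function.Injective.addCommGroup (M₁ := (M ⟶ N))
    (Gr.Hom.lin : (M ⟶ N) → (M.carrier →ₗ[Alg k r] N.carrier)) lin_injective rfl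
    (fun _ _ => rfl) (fun _ => rfl)
    (fun _ _ => rfl) (fun _ _ => rfl) (fun _ _ => rfl)

instance : Preadditive (Gr k r) where
  add_comp _ _ _ f g h := lin_injective (LinearMap.ext fun m => map_add (Gr.Hom.lin h) _ _)
  comp_add _ _ _ f g h := rfl

theorem sub_lin (f g : M ⟶ N) : Gr.Hom.lin (f - g) = Gr.Hom.lin f - Gr.Hom.lin g := rfl

/-- The first projection of a product. -/
def prodFst (M N : Gr k r) : M.prod N ⟶ M :=
  Gr.Hom.mk (LinearMap.fst _ M.carrier N.carrier) fun h => h.1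

/-- The second projection of a product. -/
def prodSnd (M N : Gr k r) : M.prod N ⟶ N :=
  Gr.Hom.mk (LinearMap.snd _ M.carrier N.carrier) fun h => h.2

/-- The first inclusion into a product. -/
def prodInl (M N : Gr k r) : M ⟶ M.prod N :=
  Gr.Hom.mk (LinearMap.inl _ M.carrier N.carrier) fun h => ⟨h, zero_mem _⟩

/-- The second inclusion into a product. -/
def prodInr (M N : Gr k r) : N ⟶ M.prod N :=
  Gr.Hom.mk (LinearMap.inr _ M.carrier N.carrier) fun h => ⟨zero_mem _, h⟩

end Preadditive

section IsoMod

variable {M N P : Gr k r}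

theorem isoModFdim_iff (f : M ⟶ N) :
    isoModFdim k r f ↔
      (∀ j, ∀ m ∈ M.deg j, Gr.Hom.lin f m = 0 → ∃ n : ℕ, ∀ b ∈ component k r n, b • m = 0) ∧
        N.IsCotorsion (LinearMap.range (Gr.Hom.lin f)) :=
  and_congr (isUnionFinDim_sub_iff (Gr.Hom.isHomogeneous_ker f))
    (isUnionFinDim_quotient_iff (Gr.Hom.isHomogeneous_range f))

/-- An element is torsion modulo `S` if all its multiples of some degree are. -/
theorem exists_smul_mem_of_smul {S : Submodule (Alg k r) M.carrier} {n : ℕ} {m : M.carrier}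
    (h : ∀ b ∈ component k r n, ∃ l : ℕ, ∀ c ∈ component k r l, c • b • m ∈ S) :
    ∃ l : ℕ, ∀ c ∈ component k r l, c • m ∈ S := by
  induction n generalizing m with
  | zero => simpa using h 1 one_mem_component
  | succ n ih =>
    have hg (i : Fin 2) : ∃ l : ℕ, ∀ c ∈ component k r l, c • gen k r i • m ∈ S := by
      refine ih fun b hb => ?_
      simpa [mul_smul] using h (b * gen k r i) (by
        simpa using mul_mem_component hb (gen_mem i))
    choose l hl using hg
    -- The sum bounds both l 0 and l 1; the extra 1 is the degree of the rightmost letter of c.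
    refine ⟨l 0 + l 1 + 1, fun c hc => ?_⟩
    rw [component_natCast, pow_succ] at hc
    induction hc using Submodule.mul_induction_on' with
    | add a _ b _ ha hb => rw [add_smul]; exact add_mem ha hb
    | mem_mul_mem a ha b hb =>
      rw [mul_smul]
      induction hb using Submodule.span_induction with
      | zero => simp
      | add b b' _ _ h h' => rw [add_smul, smul_add]; exact add_mem h h'
      | smul t b _ h =>
        rw [smul_assoc, smul_comm]
        exact (S.restrictScalars k).smul_mem t h
      | mem b hb =>
        obtain ⟨i, rfl⟩ := hb
        refine smul_mem_of_le (hl i) (i := (l 0 + l 1 : ℕ)) ?_ ha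
        fin_cases i <;> simp

theorem IsCotorsion.comp {f : M ⟶ N} {g : N ⟶ P}
    (hf : N.IsCotorsion (LinearMap.range (Gr.Hom.lin f)))
    (hg : P.IsCotorsion (LinearMap.range (Gr.Hom.lin g))) :
    P.IsCotorsion (LinearMap.range (Gr.Hom.lin (f ≫ g))) := by
  intro j p hp
  obtain ⟨n, hn⟩ := hg j p hp
  refine exists_smul_mem_of_smul (n := n) fun b hb => ?_
  obtain ⟨y, hy, e⟩ := Gr.Hom.exists_homogeneous_preimage g (P.smul_mem hb hp) (hn b hb)
  obtain ⟨l, hl⟩ := hf _ y hy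
  refine ⟨l, fun c hc => ?_⟩
  obtain ⟨x, hx⟩ := hl c hc
  exact ⟨x, by rw [comp_lin, LinearMap.comp_apply, hx, map_smul, e]⟩

instance : (isoModFdim k r).IsMultiplicative where
  id_mem M := by
    rw [isoModFdim_iff]
    refine ⟨fun j m _ h => ⟨0, fun b _ => ?_⟩, fun j m _ => ⟨0, fun b _ => ⟨b • m, rfl⟩⟩⟩
    rw [show m = 0 from h, smul_zero]
  comp_mem f g hf hg := by
    rw [isoModFdim_iff] at *
    refine ⟨fun j m hm h => ?_, hf.2.comp hg.2⟩
    obtain ⟨n, hn⟩ := hg.1 j _ (Gr.Hom.map_mem f hm) h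
    refine exists_smul_mem_of_smul (S := ⊥) (n := n) fun b hb => ?_
    simpa using hf.1 _ _ (Gr.smul_mem _ hb hm) (by rw [map_smul, hn b hb])

/-- Ore squares are graded fibre products; two morphisms that agree after s agree on the kernel of
their difference, whose inclusion is inverted. -/
instance : (isoModFdim k r).HasRightCalculusOfFractions where
  exists_rightFraction X Y φ := by
    have hs := (isoModFdim_iff _).1 φ.hs
    let d : X.prod Y ⟶ φ.Y' := prodFst X Y ≫ φ.f - prodSnd X Y ≫ φ.s
    have hd (x : X.carrier) (y : Y.carrier) :
        Gr.Hom.lin d (x, y) = Gr.Hom.lin φ.f x - Gr.Hom.lin φ.s y := rfl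
    let P := (X.prod Y).sub _ (Gr.Hom.isHomogeneous_ker d)
    let i : P ⟶ X.prod Y := subι _ _ _
    refine ⟨⟨i ≫ prodFst X Y, (isoModFdim_iff _).2 ⟨?_, ?_⟩, i ≫ prodSnd X Y⟩, ?_⟩
    · rintro j ⟨⟨x, y⟩, hxy⟩ ⟨hx, hy⟩ (h : x = 0)
      subst h
      obtain ⟨n, hn⟩ := hs.1 j y hy (by simpa [hd] using hxy)
      refine ⟨n, fun b hb => Subtype.ext (Prod.ext (smul_zero b) (hn b hb))⟩
    · intro j x hx
      obtain ⟨n, hn⟩ := hs.2 j _ (Gr.Hom.map_mem φ.f hx)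
      refine ⟨n, fun b hb => ?_⟩
      obtain ⟨y, hy⟩ := hn b hb
      refine ⟨⟨(b • x, y), ?_⟩, rfl⟩
      rw [LinearMap.mem_ker, hd, hy, map_smul, sub_self]
    · refine lin_injective (LinearMap.ext fun z => ?_)
      exact sub_eq_zero.1 ((hd _ _).symm.trans z.2)
  ext X Y Y' f₁ f₂ s hs eq := by
    rw [isoModFdim_iff] at hs
    refine ⟨X.sub _ (Gr.Hom.isHomogeneous_ker (f₁ - f₂)), subι _ _ _,
      (isoModFdim_iff _).2 ⟨?_, ?_⟩, ?_⟩
    · intro j m hm h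
      refine ⟨0, fun b _ => ?_⟩
      rw [show m = 0 from Subtype.ext h, smul_zero]
    · intro j m hm
      obtain ⟨n, hn⟩ := hs.1 j _ (Gr.Hom.map_mem (f₁ - f₂) hm) (by
        rw [sub_lin, LinearMap.sub_apply, map_sub, sub_eq_zero]
        exact LinearMap.congr_fun (congrArg Gr.Hom.lin eq) m)
      refine ⟨n, fun b hb => ⟨⟨b • m, ?_⟩, rfl⟩⟩
      rw [LinearMap.mem_ker, map_smul, hn b hb]
    · refine lin_injective (LinearMap.ext fun z => ?_)
      exact sub_eq_zero.1 z.2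

end IsoMod

end Gr

/-! ### Calculus of fractions on gr B. -/

/-- The graded free module on finitely many generators as an object of `gr B`. -/
abbrev freeFp (k : Type u) [Field k] (r : ℕ) {ι : Type} [Fintype ι] (a : ι → ℤ) : FpGr k r :=
  ⟨Gr.free k r a, inferInstanceAs (Module.FinitePresentation (Alg k r) (ι → Alg k r))⟩

namespace FpGr

variable {M N P : FpGr k r}

instance (M : FpGr k r) : Module.FinitePresentation (Alg k r) M.obj.carrier := M.property

instance (M : FpGr k r) : Module.Finite (Alg k r) M.obj.carrier := inferInstance

theorem isoModFinDim_iff (f : M ⟶ N) :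
    isoModFinDim k r f ↔ Module.Finite k (LinearMap.ker (Gr.Hom.lin f.hom)) ∧
      N.obj.IsCotorsion (LinearMap.range (Gr.Hom.lin f.hom)) := by
  refine and_congr Iff.rfl ⟨fun h => ?_, fun h => h.finite_quotient⟩
  exact (Gr.isUnionFinDim_quotient_iff (Gr.Hom.isHomogeneous_range f.hom)).1
    (@Gr.isUnionFinDim_of_finite _ _ _ _ _ _ _ _ h)

theorem isoModFdim_of_isoModFinDim {f : M ⟶ N} (hf : isoModFinDim k r f) :
    isoModFdim k r f.hom :=
  ⟨@Gr.isUnionFinDim_of_finite _ _ _ _ _ _ _ _ hf.1,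
    @Gr.isUnionFinDim_of_finite _ _ _ _ _ _ _ _ hf.2⟩

instance : (isoModFinDim k r).IsMultiplicative where
  id_mem M := by
    rw [isoModFinDim_iff]
    refine ⟨?_, ((Gr.isoModFdim_iff _).1 ((isoModFdim k r).id_mem M.obj)).2⟩
    change Module.Finite k (LinearMap.ker (LinearMap.id : M.obj.carrier →ₗ[Alg k r] _))
    rw [LinearMap.ker_id]
    infer_instance
  comp_mem f g hf hg := by
    rw [isoModFinDim_iff] at *
    refine ⟨?_, hf.2.comp hg.2⟩
    let f' := (Gr.Hom.lin f.hom).restrictScalars k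
    have hf' : (LinearMap.ker f').FG := Module.Finite.iff_fg.1 hf.1
    have hg' : Module.Finite k ((LinearMap.ker (Gr.Hom.lin g.hom)).restrictScalars k) := hg.1
    have : (((LinearMap.ker (Gr.Hom.lin g.hom)).restrictScalars k).comap f').FG := by
      refine Submodule.fg_of_fg_map_of_fg_inf_ker f' ?_ ?_
      · have := Submodule.finiteDimensional_of_le (Submodule.map_comap_le f'
          ((LinearMap.ker (Gr.Hom.lin g.hom)).restrictScalars k))
        exact Module.Finite.iff_fg.1 this
      · rwa [inf_eq_right.2 fun m hm => by
          rw [Submodule.mem_comap, LinearMap.mem_ker.1 hm]; exact zero_mem _]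
    exact Module.Finite.iff_fg.2 this

/-- Each finitely presented module receives a morphism from a graded free module that is an
isomorphism modulo finite dimensional modules, with range in a given cotorsion submodule. -/
theorem exists_free_range_le (M : FpGr k r) {S : Submodule (Alg k r) M.obj.carrier}
    (hS : M.obj.IsCotorsion S) :
    ∃ (ι : Type) (_ : Fintype ι) (a : ι → ℤ) (t : freeFp k r a ⟶ M),
      isoModFinDim k r t ∧ LinearMap.range (Gr.Hom.lin t.hom) ≤ S := by
  obtain ⟨n, hn⟩ := hS.exists_deg_le
  obtain ⟨ι, _, a, f, ha, hf, hf'⟩ := Gr.exists_free_hom M.obj n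
  refine ⟨ι, inferInstance, a, ObjectProperty.homMk f, ⟨?_, hf'⟩, Gr.range_le_of_free f ha hn⟩
  change Module.Finite k (LinearMap.ker (Gr.Hom.lin f))
  rw [LinearMap.ker_eq_bot.2 hf]
  infer_instance

theorem exists_lift {ι : Type} [Fintype ι] {a : ι → ℤ} (s : M ⟶ N) (h : freeFp k r a ⟶ N)
    (hs : LinearMap.range (Gr.Hom.lin h.hom) ≤ LinearMap.range (Gr.Hom.lin s.hom)) :
    ∃ h' : freeFp k r a ⟶ M, h' ≫ s = h := by
  obtain ⟨h', e⟩ := Gr.exists_lift_free s.hom h.hom hs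
  exact ⟨ObjectProperty.homMk h', ObjectProperty.hom_ext _ e⟩

theorem isCotorsion_comap {M N : Gr k r} (f : M ⟶ N) {S : Submodule (Alg k r) N.carrier}
    (hS : N.IsCotorsion S) : M.IsCotorsion (S.comap (Gr.Hom.lin f)) := by
  intro j m hm
  obtain ⟨n, hn⟩ := hS j _ (Gr.Hom.map_mem f hm)
  exact ⟨n, fun b hb => by rw [Submodule.mem_comap, map_smul]; exact hn b hb⟩

/-- Free modules take the place of fibre products and kernels, so no finite presentation of those
has to be checked: a free module mapped into the preimage of the range of s lifts along s. -/
instance : (isoModFinDim k r).HasRightCalculusOfFractions where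
  exists_rightFraction X Y φ := by
    obtain ⟨ι, _, a, t, ht, htS⟩ := X.exists_free_range_le
      (isCotorsion_comap φ.f.hom ((isoModFinDim_iff _).1 φ.hs).2)
    obtain ⟨g, hg⟩ := exists_lift φ.s (t ≫ φ.f) (by
      rintro _ ⟨x, rfl⟩
      exact htS ⟨x, rfl⟩)
    exact ⟨⟨t, ht, g⟩, hg.symm⟩
  ext X Y Y' f₁ f₂ s hs eq := by
    obtain ⟨ι, _, a, t, ht, htS⟩ := X.exists_free_range_le
        (S := LinearMap.ker (Gr.Hom.lin (f₁.hom - f₂.hom))) (by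
      intro j m hm
      have hs' := ((Gr.isoModFdim_iff _).1 (isoModFdim_of_isoModFinDim hs)).1
      obtain ⟨n, hn⟩ := hs' j _ (Gr.Hom.map_mem (f₁.hom - f₂.hom) hm) (by
        rw [Gr.sub_lin, LinearMap.sub_apply, map_sub, sub_eq_zero]
        exact LinearMap.congr_fun (congrArg (fun f => Gr.Hom.lin f.hom) eq) m)
      refine ⟨n, fun b hb => ?_⟩
      rw [LinearMap.mem_ker, map_smul, hn b hb])
    refine ⟨_, t, ht, ObjectProperty.hom_ext _ (Gr.lin_injective (LinearMap.ext fun z => ?_))⟩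
    exact sub_eq_zero.1 (htS ⟨z, rfl⟩)

end FpGr

/-! ### Split cokernels in qgr B. -/

namespace FpGr

open Limits

variable {M N : FpGr k r}

instance : HasZeroObject (FpGr k r) :=
  ⟨⟨freeFp k r (ι := Fin 0) Fin.elim0, (IsZero.iff_id_eq_zero _).2 <|
    ObjectProperty.hom_ext _ <| Gr.lin_injective <| LinearMap.ext fun _ => funext fun i => i.elim0⟩⟩

instance : HasBinaryBiproducts (FpGr k r) where
  has_binary_biproduct M N := hasBinaryBiproduct_of_total
    { pt := ⟨M.obj.prod N.obj, inferInstanceAs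
        (Module.FinitePresentation (Alg k r) (M.obj.carrier × N.obj.carrier))⟩
      fst := ObjectProperty.homMk (Gr.prodFst _ _)
      snd := ObjectProperty.homMk (Gr.prodSnd _ _)
      inl := ObjectProperty.homMk (Gr.prodInl _ _)
      inr := ObjectProperty.homMk (Gr.prodInr _ _)
      inl_fst := rfl
      inl_snd := rfl
      inr_fst := rfl
      inr_snd := rfl }
    (ObjectProperty.hom_ext _ <| Gr.lin_injective <| LinearMap.ext fun z =>
      Prod.ext (add_zero z.1) (zero_add z.2))

instance : HasFiniteProducts (FpGr k r) := hasFiniteProducts_of_has_binary_and_terminal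

theorem exists_cokernel (f : M ⟶ N) :
    ∃ (C : FpGr k r) (p : N ⟶ C), Function.Surjective (Gr.Hom.lin p.hom) ∧
      LinearMap.ker (Gr.Hom.lin p.hom) = LinearMap.range (Gr.Hom.lin f.hom) := by
  have hf := Gr.Hom.isHomogeneous_range f.hom
  refine ⟨⟨N.obj.quot _ hf, ?_⟩, ObjectProperty.homMk (Gr.quotπ _ _ hf),
    Submodule.mkQ_surjective _, Submodule.ker_mkQ _⟩
  refine Module.finitePresentation_of_surjective
    (LinearMap.range (Gr.Hom.lin f.hom)).mkQ (Submodule.mkQ_surjective _) ?_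
  rw [Submodule.ker_mkQ, LinearMap.range_eq_map]
  exact Module.Finite.fg_top.map _

variable [Preadditive (FpQGr k r)] [(isoModFinDim k r).Q.Additive]

theorem exists_split_cokernel_of_free {ι : Type} [Fintype ι] {a : ι → ℤ} {N : FpGr k r}
    (f : freeFp k r a ⟶ N) :
    ∃ (g : (isoModFinDim k r).Q.obj N ⟶ (isoModFinDim k r).Q.obj (freeFp k r a))
      (Z : FpQGr k r) (p : (isoModFinDim k r).Q.obj N ⟶ Z)
      (s : Z ⟶ (isoModFinDim k r).Q.obj N), (isoModFinDim k r).Q.map f ≫ p = 0 ∧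
      s ≫ p = 𝟙 Z ∧ g ≫ (isoModFinDim k r).Q.map f + p ≫ s = 𝟙 _ := by
  obtain ⟨C, p, hp, hpf⟩ := exists_cokernel f
  -- ν replaces C by a free module and its lift σ to N splits p once ν is inverted. Likewise j
  -- replaces N, with range small enough for j p to factor as θ ν.
  obtain ⟨_, _, b, ν, hν, -⟩ := C.exists_free_range_le (S := ⊤)
    (fun j m _ => ⟨0, fun _ _ => Submodule.mem_top⟩)
  obtain ⟨σ, hσ⟩ := exists_lift p ν (by rw [LinearMap.range_eq_top.2 hp]; exact le_top)
  obtain ⟨_, _, c, j, hj, hjp⟩ := N.exists_free_range_le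
    (isCotorsion_comap p.hom ((isoModFinDim_iff ν).1 hν).2)
  obtain ⟨θ, hθ⟩ := exists_lift ν (j ≫ p) (by
    rintro _ ⟨x, rfl⟩
    exact hjp ⟨x, rfl⟩)
  -- The difference is killed by p, so it lands in the range of f; hence j = ψ f + θ σ, which
  -- becomes the splitting identity once j is inverted.
  obtain ⟨ψ, hψ⟩ := exists_lift f (j - θ ≫ σ) (by
    have : (j - θ ≫ σ) ≫ p = 0 := by
      rw [Preadditive.sub_comp, Category.assoc, hσ, hθ, sub_self]
    rw [← hpf]
    rintro _ ⟨x, rfl⟩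
    exact LinearMap.congr_fun (congrArg (fun f => Gr.Hom.lin f.hom) this) x)
  set Q := (isoModFinDim k r).Q
  have : IsIso (Q.map ν) := Localization.inverts Q _ _ hν
  have : IsIso (Q.map j) := Localization.inverts Q _ _ hj
  refine ⟨inv (Q.map j) ≫ Q.map ψ, Q.obj C, Q.map p, inv (Q.map ν) ≫ Q.map σ, ?_, ?_, ?_⟩
  · have : f ≫ p = 0 := ObjectProperty.hom_ext _ <| Gr.lin_injective <| LinearMap.ext fun x =>
      (LinearMap.mem_ker.1 (hpf ▸ ⟨x, rfl⟩ : Gr.Hom.lin f.hom x ∈ LinearMap.ker _))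
    rw [← Q.map_comp, this, Q.map_zero]
  · rw [Category.assoc, ← Q.map_comp, hσ, IsIso.inv_hom_id]
  · rw [← cancel_epi (Q.map j), Preadditive.comp_add, Category.assoc, IsIso.hom_inv_id_assoc,
      ← Q.map_comp, hψ, ← Q.map_comp_assoc, ← hθ, Q.map_comp, Category.assoc,
      IsIso.hom_inv_id_assoc, ← Q.map_comp, ← Q.map_add, sub_add_cancel, Category.comp_id]

/-- Up to an isomorphism of the source, a right fraction is the image of a morphism from a free
module. -/
theorem exists_split_cokernel {M N : FpGr k r}
    (f : (isoModFinDim k r).Q.obj M ⟶ (isoModFinDim k r).Q.obj N) :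
    ∃ (g : (isoModFinDim k r).Q.obj N ⟶ (isoModFinDim k r).Q.obj M)
      (Z : FpQGr k r) (p : (isoModFinDim k r).Q.obj N ⟶ Z)
      (s : Z ⟶ (isoModFinDim k r).Q.obj N), f ≫ p = 0 ∧ s ≫ p = 𝟙 Z ∧
      g ≫ f + p ≫ s = 𝟙 _ := by
  obtain ⟨φ, hφ⟩ := Localization.exists_rightFraction (isoModFinDim k r).Q (isoModFinDim k r) f
  obtain ⟨ι, _, a, t, ht, -⟩ := φ.X'.exists_free_range_le (S := ⊤)
    (fun j m _ => ⟨0, fun _ _ => Submodule.mem_top⟩)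
  have : IsIso ((isoModFinDim k r).Q.map φ.s) := Localization.inverts (isoModFinDim k r).Q _ _ φ.hs
  have : IsIso ((isoModFinDim k r).Q.map t) := Localization.inverts (isoModFinDim k r).Q _ _ ht
  have e : (isoModFinDim k r).Q.map t ≫ (isoModFinDim k r).Q.map φ.s ≫ f =
      (isoModFinDim k r).Q.map (t ≫ φ.f) := by
    rw [hφ, MorphismProperty.RightFraction.map_s_comp_map, (isoModFinDim k r).Q.map_comp]
  obtain ⟨g, Z, p, s, h₁, h₂, h₃⟩ := exists_split_cokernel_of_free (t ≫ φ.f)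
  refine ⟨g ≫ (isoModFinDim k r).Q.map t ≫ (isoModFinDim k r).Q.map φ.s, Z, p, s, ?_, h₂, ?_⟩
  · rw [← cancel_epi ((isoModFinDim k r).Q.map φ.s), ← cancel_epi ((isoModFinDim k r).Q.map t)]
    rw [comp_zero, comp_zero, ← h₁, ← e]
    simp only [Category.assoc]
  · rw [Category.assoc, Category.assoc, e]
    exact h₃

theorem hasSplitCokernels : HasSplitCokernels (FpQGr k r) := by
  intro X Y f
  obtain ⟨M, rfl⟩ := (Localization.Construction.objEquiv (isoModFinDim k r)).surjective X
  obtain ⟨N, rfl⟩ := (Localization.Construction.objEquiv (isoModFinDim k r)).surjective Y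
  exact exists_split_cokernel f

end FpGr

/-! ### Projectivity in QGr B. -/

namespace Gr

/-- The projection modulo the range of g becomes zero in QGr B, so some inverted s composes with it
to zero. Then range s ⊆ range g, and range s already has torsion quotient. -/
theorem isCotorsion_range_of_epi {M N : Gr k r} (g : M ⟶ N) [Epi ((betaStar k r).map g)] :
    N.IsCotorsion (LinearMap.range (Gr.Hom.lin g)) := by
  let p := quotπ N _ (Gr.Hom.isHomogeneous_range g)
  -- With zero written as g ≫ 0, cancelling the epimorphism requires no additive structure on QGr B.
  have hp : g ≫ p = g ≫ 0 := lin_injective <| LinearMap.ext fun x =>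
    (Submodule.Quotient.mk_eq_zero _).2 ⟨x, rfl⟩
  have hp' : (betaStar k r).map p = (betaStar k r).map 0 := by
    rw [← cancel_epi ((betaStar k r).map g), ← Functor.map_comp, ← Functor.map_comp, hp]
  obtain ⟨Z, s, hs, e⟩ :=
    (MorphismProperty.map_eq_iff_precomp (betaStar k r) (isoModFdim k r) _ _).1 hp'
  intro j n hn
  obtain ⟨l, hl⟩ := ((isoModFdim_iff s).1 hs).2 j n hn
  refine ⟨l, fun b hb => ?_⟩
  obtain ⟨z, hz⟩ := hl b hb
  rw [← hz]
  exact (Submodule.Quotient.mk_eq_zero _).1 (LinearMap.congr_fun (congrArg Gr.Hom.lin e) z)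

end Gr

/-- With f and e written as roofs, a free replacement of M absorbs the denominator of f. A second
one, mapping into the preimage of the range of the numerator of e, lifts through that numerator.
Only M has to be finitely presented. -/
theorem exists_lift_betaStar {M : FpGr k r} {A N : Gr k r}
    (f : (betaStar k r).obj M.obj ⟶ (betaStar k r).obj N)
    (e : (betaStar k r).obj A ⟶ (betaStar k r).obj N) [Epi e] : ∃ l, l ≫ e = f := by
  obtain ⟨φ, hφ⟩ := Localization.exists_rightFraction (betaStar k r) (isoModFdim k r) f
  obtain ⟨ε, hε⟩ := Localization.exists_rightFraction (betaStar k r) (isoModFdim k r) e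
  have : IsIso ((betaStar k r).map φ.s) := Localization.inverts (betaStar k r) _ _ φ.hs
  have : IsIso ((betaStar k r).map ε.s) := Localization.inverts (betaStar k r) _ _ ε.hs
  have hf : (betaStar k r).map φ.s ≫ f = (betaStar k r).map φ.f := by
    rw [hφ, MorphismProperty.RightFraction.map_s_comp_map]
  have he : (betaStar k r).map ε.s ≫ e = (betaStar k r).map ε.f := by
    rw [hε, MorphismProperty.RightFraction.map_s_comp_map]
  have : Epi ((betaStar k r).map ε.f) := by
    rw [← he]
    infer_instance
  obtain ⟨ι, _, a, t, ht, hts⟩ := M.exists_free_range_le ((Gr.isoModFdim_iff _).1 φ.hs).2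
  obtain ⟨t', ht'⟩ := Gr.exists_lift_free φ.s t.hom hts
  obtain ⟨κ, _, b, w, hw, hwε⟩ := (freeFp k r a).exists_free_range_le
    (FpGr.isCotorsion_comap (t' ≫ φ.f) (Gr.isCotorsion_range_of_epi ε.f))
  obtain ⟨l, hl⟩ := Gr.exists_lift_free ε.f (w.hom ≫ t' ≫ φ.f) (by
    rintro _ ⟨x, rfl⟩
    exact hwε ⟨x, rfl⟩)
  have : IsIso ((betaStar k r).map t.hom) :=
    Localization.inverts (betaStar k r) _ _ (FpGr.isoModFdim_of_isoModFinDim ht)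
  have : IsIso ((betaStar k r).map w.hom) :=
    Localization.inverts (betaStar k r) _ _ (FpGr.isoModFdim_of_isoModFinDim hw)
  refine ⟨inv ((betaStar k r).map t.hom) ≫ inv ((betaStar k r).map w.hom) ≫
    (betaStar k r).map l ≫ (betaStar k r).map ε.s, ?_⟩
  rw [← cancel_epi ((betaStar k r).map t.hom), ← cancel_epi ((betaStar k r).map w.hom)]
  simp only [Category.assoc, IsIso.hom_inv_id_assoc, he]
  rw [← (betaStar k r).map_comp, hl, ← ht', (betaStar k r).map_comp, (betaStar k r).map_comp,
    (betaStar k r).map_comp, Category.assoc, hf]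

theorem projective_betaStar (M : FpGr k r) : Projective ((betaStar k r).obj M.obj) where
  factors {E X} f e he := by
    obtain ⟨A, rfl⟩ := (Localization.Construction.objEquiv (isoModFdim k r)).surjective E
    obtain ⟨N, rfl⟩ := (Localization.Construction.objEquiv (isoModFdim k r)).surjective X
    exact @exists_lift_betaStar k _ r M A N f e he

end PenroseCurve

theorem corollary1p3 (k : Type*) [Field k] (r : ℕ) (hr : 1 ≤ r) :
    (∃ _ : Abelian (PenroseCurve.FpQGr k r),
      (∀ X : PenroseCurve.FpQGr k r, Injective X ∧ Projective X) ∧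
      (∀ S : ShortComplex (PenroseCurve.FpQGr k r), S.ShortExact → Nonempty S.Splitting)) ∧
    (∀ M : PenroseCurve.FpGr k r, Projective ((PenroseCurve.betaStar k r).obj M.obj)) := by
  refine ⟨?_, PenroseCurve.projective_betaStar⟩
  obtain ⟨_, _⟩ := PenroseCurve.exists_preadditive_localization (PenroseCurve.isoModFinDim k r)
  have h := PenroseCurve.FpGr.hasSplitCokernels (k := k) (r := r)
  have : Limits.HasFiniteProducts (PenroseCurve.FpQGr k r) :=
    (PenroseCurve.isoModFinDim k r).Q.hasFiniteProducts_of_additive_of_essSurj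
  exact ⟨h.abelian, fun X => ⟨h.injective X, h.projective X⟩, h.nonempty_splitting⟩
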